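/- **Setting (problem).** Let $m$ be the number of agents, let $\mathcal K\subseteq\mathbb R^d$ be nonempty, closed and convex, and let $\mathcal O\supseteq\mathcal K$ be open. Consider $$\min_{x\in\mathcal K}\;U(x):=F(x)+G(x),\qquad F:=\frac1m\sum_{i=1}^m f_i,\qquad U^\star:=\inf_{x\in\mathcal K}U(x),$$ where each $f_i:\mathcal O\to\mathbb R$ is convex and twice differentiable, $G:\mathcal K\to\mathbb R$ is convex, and there are constants $\mu>0$ and $0<L<\infty$ with $\mu I\preceq\nabla^2F(x)\preceq L I$ for all $x\in\mathcal K$. **Setting (network and weights).** Let $\mathcal G^\nu=(\{1,\dots,m\},\mathcal E^\nu)$, $\nu=0,1,\dots$, be digraphs, where $(i,j)\in\mathcal E^\nu$ is a link from $i$ to $j$. Assume the sequence is $B$-strongly connected for some integer $B>0$: for every $\nu\ge0$ the digraph with edge set $\bigcup_{t=\nu B}^{(\nu+1)B-1}\mathcal E^t$ is strongly connected. Let $C^\nu=(c^\nu_{ij})$ be real $m\times m$ matrices and $c_\ell>0$ a constant such that, for all $\nu$: $c^\nu_{ii}\ge c_\ell$ for all $i$; for $i\ne j$, $c^\nu_{ij}\ge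 c_\ell$ if $(j,i)\in\mathcal E^\nu$ and $c^\nu_{ij}=0$ otherwise; and $\mathbf 1^\top C^\nu=\mathbf 1^\top$. **Setting (surrogates).** For each $i$ let $\tilde f_i(\cdot\,;\cdot):\mathcal O\times\mathcal O\to\mathbb R$ be $C^2$, with $\nabla\tilde f_i$ and $\nabla^2\tilde f_i$ denoting derivatives in the first argument, such that for all $x\in\mathcal K$: (i) $\nabla\tilde f_i(x;x)=\nabla f_i(x)$; (ii) $\nabla\tilde f_i(\cdot\,;x)$ is $\tilde L_i$-Lipschitz on $\mathcal K$; (iii) $\tilde f_i(\cdot\,;x)$ is $\tilde\mu_i$-strongly convex on $\mathcal K$, with $\tilde\mu_i>0$. Let $D_i^\ell\in\mathbb R$ be constants with $$u^\top\big(\nabla^2\tilde f_i(x;y)-\nabla^2F(x)\big)u\;\ge\;D_i^\ell\|u\|^2\qquad\text{for all }x,y\in\mathcal K\text{ and all }u\in\operatorname{span}(\mathcal K-\mathcal K)$$ (that is, $D_i^\ell I\preceq\nabla^2\tilde f_i(x;y)-\nabla^2F(x)$ when $\mathcal K$ has nonempty interior), and put $\tilde\mu_{\min}:=\min_i\tilde\mu_i$,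 $D^\ell_{\min}:=\min_iD^\ell_i$. Assume $\tilde\mu_{\min}\ge D^\ell_{\min}$. **Algorithm (SONATA with perturbed push-sum, step size $\alpha$).** Start from any $x_i^0\in\mathcal K$, with $y_i^0=\nabla f_i(x_i^0)$ and $\phi_i^0=1$. For $\nu=0,1,2,\dots$ every agent $i$ computes $$\hat x_i^\nu\in\operatorname*{argmin}_{z\in\mathcal K}\;\tilde f_i(z;x_i^\nu)+\big(y_i^\nu-\nabla f_i(x_i^\nu)\big)^\top(z-x_i^\nu)+G(z),\qquad x_i^{\nu+\frac12}=x_i^\nu+\alpha(\hat x_i^\nu-x_i^\nu),$$ $$\phi_i^{\nu+1}=\sum_{j=1}^mc^\nu_{ij}\phi^\nu_j,\qquad x_i^{\nu+1}=\frac1{\phi_i^{\nu+1}}\sum_{j=1}^mc^\nu_{ij}\phi_j^\nu\,x_j^{\nu+\frac12},$$ $$y_i^{\nu+1}=\frac1{\phi_i^{\nu+1}}\sum_{j=1}^mc^\nu_{ij}\Big(\phi_j^\nu y_j^\nu+\nabla f_j(x_j^{\nu+1})-\nabla f_j(x_j^\nu)\Big).$$ **Theorem.** There exists $\bar\alpha\in(0,1]$,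 not depending on the initial points $x_i^0$, such that for every $\alpha\in(0,\bar\alpha)$, every sequence generated by the algorithm with step size $\alpha$, and every agent $i$, $U(x_i^\nu)$ converges to $U^\star$ at an R-linear rate: there are $z\in(0,1)$ and $c\in\mathbb R$ with $|U(x_i^\nu)-U^\star|\le c\,z^\nu$ for all $\nu\ge0$. -/

import Mathlib

noncomputable section

namespace Sonata

/-- The Euclidean space `ℝ^d`. -/
abbrev Vec (d : ℕ) : Type := EuclideanSpace ℝ (Fin d)

/-- The average loss `F = (1/m) ∑ i, f i`. -/
def avgLoss {m d : ℕ} (f : Fin m → Vec d → ℝ) (x : Vec d) : ℝ :=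
  (1 / (m : ℝ)) * ∑ i, f i x

/-- The objective `U = F + G`. -/
def objective {m d : ℕ} (f : Fin m → Vec d → ℝ) (G : Vec d → ℝ) (x : Vec d) : ℝ :=
  avgLoss f x + G x

/-- The optimal value `U⋆` of `U = F + G` over the constraint set `K`. -/
def optValue {m d : ℕ} (K : Set (Vec d)) (f : Fin m → Vec d → ℝ) (G : Vec d → ℝ) : ℝ :=
  sInf (objective f G '' K)

/-- The Hessian of `g` at `x`, as the derivative of the gradient map. -/
def hess {d : ℕ} (g : Vec d → ℝ) (x : Vec d) : Vec d →L[ℝ] Vec d :=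
  fderiv ℝ (gradient g) x

/-- The quadratic form `uᵀ ∇²g(x) u`. -/
def hessForm {d : ℕ} (g : Vec d → ℝ) (x u : Vec d) : ℝ :=
  inner ℝ (hess g x u) u

/-- The assumptions on the problem `min_{x ∈ K} F(x) + G(x)`. The losses live on the open set `O`;
values of `f i` outside `O` and of `G` outside `K` play no role. -/
structure ProblemAssumption {m d : ℕ} (K O : Set (Vec d)) (f : Fin m → Vec d → ℝ)
    (G : Vec d → ℝ) (μ L : ℝ) : Prop where
  nonempty : K.Nonempty
  isClosed : IsClosed K
  convex : Convex ℝ K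
  isOpen : IsOpen O
  subset : K ⊆ O
  loss_convex : ∀ i, ConvexOn ℝ O (f i)
  loss_differentiable : ∀ i, DifferentiableOn ℝ (f i) O
  loss_twice_differentiable : ∀ i, DifferentiableOn ℝ (gradient (f i)) O
  mu_pos : 0 < μ
  L_pos : 0 < L
  hess_lower : ∀ x ∈ K, ∀ u, μ * ‖u‖ ^ 2 ≤ hessForm (avgLoss f) x u
  hess_upper : ∀ x ∈ K, ∀ u, hessForm (avgLoss f) x u ≤ L * ‖u‖ ^ 2
  reg_convex : ConvexOn ℝ K G

/-- The assumptions on the surrogates; `ft i z x` is `f̃ᵢ(z ; x)`, and all gradients are partial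
gradients in the first argument. -/
structure SurrogateAssumption {m d : ℕ} (K O : Set (Vec d)) (f : Fin m → Vec d → ℝ)
    (ft : Fin m → Vec d → Vec d → ℝ) (μt Lt : Fin m → ℝ) : Prop where
  contDiff : ∀ i, ContDiffOn ℝ 2 (fun p : Vec d × Vec d => ft i p.1 p.2) (O ×ˢ O)
  gradient_eq : ∀ i, ∀ x ∈ K, gradient (fun z => ft i z x) x = gradient (f i) x
  gradient_lipschitz : ∀ i, ∀ x ∈ K, ∀ z ∈ K, ∀ w ∈ K,
    ‖gradient (fun v => ft i v x) z - gradient (fun v => ft i v x) w‖ ≤ Lt i * ‖z - w‖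
  mu_pos : ∀ i, 0 < μt i
  strongConvex : ∀ i, ∀ x ∈ K, StrongConvexOn K (μt i) (fun z => ft i z x)

/-- `Dl i` is a lower bound of the Hessian gap `∇² f̃ᵢ(x ; y) - ∇² F(x)` over `x, y ∈ K`. The
quadratic form is only tested on directions parallel to the affine hull of `K`; these are all
vectors as soon as `K` has an interior point. -/
def HessianGapLowerBound {m d : ℕ} (K : Set (Vec d)) (f : Fin m → Vec d → ℝ)
    (ft : Fin m → Vec d → Vec d → ℝ) (Dl : Fin m → ℝ) : Prop :=
  ∀ i, ∀ x ∈ K, ∀ y ∈ K, ∀ u ∈ vectorSpan ℝ K,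
    Dl i * ‖u‖ ^ 2 ≤ hessForm (fun z => ft i z y) x u - hessForm (avgLoss f) x u

/-- The digraph sequence `𝓖` is `B`-strongly connected: for each `ν`, the union of the edge sets
over the window `νB ≤ t < (ν+1)B` contains a directed path from any agent to any other. -/
def IsBStronglyConnected {m : ℕ} (𝓖 : ℕ → Digraph (Fin m)) (B : ℕ) : Prop :=
  0 < B ∧ ∀ ν : ℕ, ∀ i j : Fin m,
    Relation.ReflTransGen
      (fun a b => ∃ t : ℕ, ν * B ≤ t ∧ t < (ν + 1) * B ∧ (𝓖 t).Adj a b) i j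

/-- The weights are compliant with the digraphs, bounded below by `cl > 0` on the edges and on the
diagonal, and column stochastic. `(𝓖 ν).Adj j i` is a link from `j` to `i`; self-loops are not
required in `𝓖 ν`. -/
structure WeightAssumption {m : ℕ} (𝓖 : ℕ → Digraph (Fin m))
    (C : ℕ → Matrix (Fin m) (Fin m) ℝ) (cl : ℝ) : Prop where
  cl_pos : 0 < cl
  diag : ∀ ν i, cl ≤ C ν i i
  edge : ∀ ν i j, i ≠ j → (𝓖 ν).Adj j i → cl ≤ C ν i j
  not_edge : ∀ ν i j, i ≠ j → ¬ (𝓖 ν).Adj j i → C ν i j = 0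
  column_stochastic : ∀ ν j, ∑ i, C ν i j = 1

/-- `(x, xhat, y, φ)` is a run of SONATA with perturbed push-sum, weights `C` and step size `α`. -/
structure IsRun {m d : ℕ} (K : Set (Vec d)) (f : Fin m → Vec d → ℝ)
    (ft : Fin m → Vec d → Vec d → ℝ) (G : Vec d → ℝ) (C : ℕ → Matrix (Fin m) (Fin m) ℝ) (α : ℝ)
    (x xhat y : ℕ → Fin m → Vec d) (φ : ℕ → Fin m → ℝ) : Prop where
  x_init : ∀ i, x 0 i ∈ K
  y_init : ∀ i, y 0 i = gradient (f i) (x 0 i)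
  φ_init : ∀ i, φ 0 i = 1
  xhat_mem : ∀ ν i, xhat ν i ∈ K
  xhat_min : ∀ ν i, IsMinOn
    (fun z => ft i z (x ν i) + inner ℝ (y ν i - gradient (f i) (x ν i)) (z - x ν i) + G z)
    K (xhat ν i)
  φ_step : ∀ ν i, φ (ν + 1) i = ∑ j, C ν i j * φ ν j
  x_step : ∀ ν i, x (ν + 1) i =
    (1 / φ (ν + 1) i) • ∑ j, (C ν i j * φ ν j) • (x ν j + α • (xhat ν j - x ν j))
  y_step : ∀ ν i, y (ν + 1) i =
    (1 / φ (ν + 1) i) • ∑ j, C ν i j •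
      (φ ν j • y ν j + gradient (f j) (x (ν + 1) j) - gradient (f j) (x ν j))

/-- `u` converges to `l` at an R-linear rate: `|u ν - l| = O(z ^ ν)` for some `z ∈ (0, 1)`. -/
def ConvergesRLinearly (u : ℕ → ℝ) (l : ℝ) : Prop :=
  ∃ z : ℝ, 0 < z ∧ z < 1 ∧ ∃ c : ℝ, ∀ ν : ℕ, |u ν - l| ≤ c * z ^ ν

end Sonata

end

/-!
The proof follows three coupled scalar quantities of a run: the `φ`-weighted optimality gap `p` of
the agents, and measures `X`, `Y` of the disagreement of the iterates and of the gradient estimates.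

* Mixing contracts disagreement. Push-sum acts on the iterates through the row-stochastic weights
  `C ν i j * φ ν j / φ (ν + 1) i`. Strong connectivity makes all products over `(m + 1) B` steps
  entrywise bounded below (`pow_le_transition`), and such products shrink the largest distance
  between agents (`spread_mix_le`). Summing the spread over the next `(m + 1) B` mixing steps gives a
  functional that contracts at every single step (`WeightAssumption.exists_contraction`). It is
  perturbed by the local steps, of size `α r`, and by the changes of the local gradients, which are
  Lipschitz on `K` because each `∇² f i` is nonnegative and bounded by `m ∇² F`.
* A damped step towards the best response contracts the optimality gap by a factor `1 - θ α`, gains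
  `α κ r ^ 2`, and loses `α` times the squared error of the gradient estimate
  (`IsBestResponse.objective_step_le`). By gradient tracking this error is at most a multiple of
  `X + Y` (`IsRun.norm_gradient_sub_le`). Mixing does not increase the weighted gap, by Jensen's
  inequality and column stochasticity (`IsRun.sum_phi_mul_le`).
* For small `α` the loop closes (`exists_geometric_bound`): `X` and `Y` are driven by `α r`, so their
  contribution to `p` is of order `α ^ 3 r ^ 2`, which the gain `α κ r ^ 2` absorbs.

All comparisons are with arbitrary points of `K` rather than with a minimizer of `U`, which need not
exist: `G` is convex on `K` but not necessarily lower semicontinuous. That `U` is bounded below on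
`K` follows from the solvability of the subproblems along a run. For small step sizes the strong
convexity of the surrogates and the Lipschitz constants of the gradients suffice for all estimates.
-/

noncomputable section

namespace Sonata

/-! ### Products of mixing matrices -/

section Mixing

variable {ι : Type*} [Fintype ι] [DecidableEq ι]

/-- The transition matrix `W (ν + k - 1) ⋯ W (ν + 1) W ν` of `k` mixing steps started at time `ν`. -/
def transition (W : ℕ → Matrix ι ι ℝ) : ℕ → ℕ → Matrix ι ι ℝ
  | _, 0 => 1
  | ν, k + 1 => transition W (ν + 1) k * W ν

theorem transition_succ' (W : ℕ → Matrix ι ι ℝ) (ν k : ℕ) :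
    transition W ν (k + 1) = W (ν + k) * transition W ν k := by
  induction k generalizing ν with
  | zero => simp [transition]
  | succ k ih =>
    rw [transition, ih, Matrix.mul_assoc, ← transition]
    congr 2
    omega

theorem transition_nonneg {W : ℕ → Matrix ι ι ℝ} (hW : ∀ ν i j, 0 ≤ W ν i j) (ν k : ℕ) (i j : ι) :
    0 ≤ transition W ν k i j := by
  induction k generalizing ν i j with
  | zero => simp only [transition, Matrix.one_apply]; split_ifs <;> norm_num
  | succ k ih =>
    rw [transition, Matrix.mul_apply]
    exact Finset.sum_nonneg fun l _ => mul_nonneg (ih _ _ _) (hW _ _ _)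

theorem transition_row_sum {W : ℕ → Matrix ι ι ℝ} (hW : ∀ ν i, ∑ j, W ν i j = 1) (ν k : ℕ) (i : ι) :
    ∑ j, transition W ν k i j = 1 := by
  induction k generalizing ν i with
  | zero => simp [transition, Matrix.one_apply]
  | succ k ih =>
    simp only [transition, Matrix.mul_apply]
    rw [Finset.sum_comm]
    simp only [← Finset.mul_sum, hW, mul_one, ih]

/-- An agent holding at least `c ^ k` of the mass of agent `j` after `k` steps passes at least
`c ^ (k + 1)` of it to every agent it has a link of weight at least `c` to. -/
theorem pow_le_transition_succ {W : ℕ → Matrix ι ι ℝ} (hW : ∀ ν i j, 0 ≤ W ν i j) {c : ℝ}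
    (hc : 0 ≤ c) {ν k : ℕ} {a b j : ι} (ha : c ^ k ≤ transition W ν k a j)
    (hab : c ≤ W (ν + k) b a) : c ^ (k + 1) ≤ transition W ν (k + 1) b j := by
  rw [transition_succ', Matrix.mul_apply, pow_succ']
  calc c * c ^ k ≤ W (ν + k) b a * transition W ν k a j :=
        mul_le_mul hab ha (by positivity) (hW _ _ _)
    _ ≤ _ := Finset.single_le_sum
        (f := fun l => W (ν + k) b l * transition W ν k l j)
        (fun l _ => mul_nonneg (hW _ _ _) (transition_nonneg hW _ _ _ _)) (Finset.mem_univ a)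

end Mixing

/-- The window of `(m + 1) B` steps contains `m` whole windows `[w B, (w + 1) B)`. In each of them
the set of agents reached from `j` grows, unless it is already everything, because some edge leaves
it. -/
theorem pow_le_transition {m B : ℕ} {𝓖 : ℕ → Digraph (Fin m)} (hB : IsBStronglyConnected 𝓖 B)
    {W : ℕ → Matrix (Fin m) (Fin m) ℝ} (hW : ∀ ν i j, 0 ≤ W ν i j) {c : ℝ} (hc : 0 ≤ c)
    (hdiag : ∀ ν i, c ≤ W ν i i) (hedge : ∀ ν i j, (𝓖 ν).Adj j i → c ≤ W ν i j)
    (ν : ℕ) (i j : Fin m) :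
    c ^ ((m + 1) * B) ≤ transition W ν ((m + 1) * B) i j := by
  classical
  obtain ⟨hB0, hconn⟩ := hB
  let S : ℕ → Finset (Fin m) := fun k => {i | c ^ k ≤ transition W ν k i j}
  have hS : ∀ k i, i ∈ S k ↔ c ^ k ≤ transition W ν k i j := fun k i => by simp [S]
  have hmono : Monotone S := monotone_nat_of_le_succ fun k i hi => by
    rw [hS] at hi ⊢
    exact pow_le_transition_succ hW hc hi (hdiag _ _)
  have hj : ∀ k, j ∈ S k := fun k => hmono (Nat.zero_le k) (by simp [hS, transition])
  have hgrow : ∀ w k, ν + k = w * B → S k ≠ Finset.univ → (S k).card < (S (k + B)).card := by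
    intro w k hk hne
    refine Finset.card_lt_card ((hmono (Nat.le_add_right k B)).lt_of_ne fun heq => hne ?_)
    ext i
    simp only [Finset.mem_univ, iff_true]
    induction hconn w j i with
    | refl => exact hj k
    | tail _ hab ih =>
      obtain ⟨t, h1, h2, hadj⟩ := hab
      rw [Nat.add_mul, one_mul] at h2
      obtain ⟨s, rfl⟩ : ∃ s, t = ν + s := ⟨t - ν, by omega⟩
      have h3 := hmono (show k ≤ s by omega) ih
      rw [hS] at h3
      have h4 := pow_le_transition_succ hW hc h3 (hedge _ _ _ hadj)
      rw [← hS] at h4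
      rw [heq]
      exact hmono (by omega) h4
  -- the first multiple of `B` that is at least `ν`
  obtain ⟨w, k, hk, hkB⟩ : ∃ w k, ν + k = w * B ∧ k ≤ B := by
    refine ⟨ν / B + 1, B - ν % B, ?_, Nat.sub_le _ _⟩
    have := Nat.mod_lt ν hB0
    have := Nat.div_add_mod' ν B
    rw [Nat.add_mul, one_mul]
    omega
  have hcount : ∀ n, n + 1 ≤ (S (k + n * B)).card ∨ S (k + n * B) = Finset.univ := by
    intro n
    induction n with
    | zero => exact Or.inl (Finset.card_pos.2 ⟨j, hj _⟩)
    | succ n ih =>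
      have e : k + (n + 1) * B = k + n * B + B := by ring
      rw [e]
      by_cases h : S (k + n * B) = Finset.univ
      · exact Or.inr (Finset.univ_subset_iff.1 (h ▸ hmono (Nat.le_add_right (k + n * B) B)))
      · have := hgrow (w + n) (k + n * B) (by rw [Nat.add_mul, ← hk]; ring) h
        have := ih.resolve_right h
        exact Or.inl (by omega)
  have huniv : S (k + m * B) = Finset.univ := by
    refine (hcount m).resolve_left fun h => ?_
    have := Finset.card_le_univ (S (k + m * B))
    rw [Fintype.card_fin] at this
    omega
  rw [← hS]
  refine hmono (show k + m * B ≤ (m + 1) * B by rw [Nat.add_mul, one_mul]; omega) ?_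
  simp [huniv]

/-! ### Contraction of disagreement under mixing -/

section Spread

variable {ι : Type*} [Fintype ι] {E : Type*} [NormedAddCommGroup E]

/-- The largest distance between two agents, as a sup norm. -/
def spread (x : ι → E) : ℝ := ‖fun p : ι × ι => x p.1 - x p.2‖

theorem spread_nonneg (x : ι → E) : 0 ≤ spread x := norm_nonneg _

theorem norm_sub_le_spread (x : ι → E) (i j : ι) : ‖x i - x j‖ ≤ spread x :=
  norm_le_pi_norm (fun p : ι × ι => x p.1 - x p.2) (i, j)

theorem spread_le {x : ι → E} {r : ℝ} (hr : 0 ≤ r) (h : ∀ i j, ‖x i - x j‖ ≤ r) : spread x ≤ r :=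
  (pi_norm_le_iff_of_nonneg hr).2 fun p => h p.1 p.2

theorem spread_add_le (x y : ι → E) : spread (x + y) ≤ spread x + spread y :=
  spread_le (add_nonneg (spread_nonneg _) (spread_nonneg _)) fun i j => by
    have e : (x + y) i - (x + y) j = (x i - x j) + (y i - y j) := by
      simp only [Pi.add_apply]; abel
    rw [e]
    exact (norm_add_le _ _).trans (add_le_add (norm_sub_le_spread _ _ _) (norm_sub_le_spread _ _ _))

theorem spread_le_two_mul_norm (x : ι → E) : spread x ≤ 2 * ‖x‖ :=
  spread_le (by positivity) fun i j => by
    linarith [norm_sub_le (x i) (x j), norm_le_pi_norm x i, norm_le_pi_norm x j]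

variable [NormedSpace ℝ E]

/-- One mixing step: agent `i` receives `∑ j, A i j • x j`. -/
def mix (A : Matrix ι ι ℝ) (x : ι → E) : ι → E := fun i => ∑ j, A i j • x j

theorem mix_add (A : Matrix ι ι ℝ) (x y : ι → E) : mix A (x + y) = mix A x + mix A y := by
  ext i; simp [mix, Finset.sum_add_distrib]

theorem mix_mul (A A' : Matrix ι ι ℝ) (x : ι → E) : mix (A * A') x = mix A (mix A' x) := by
  ext i
  simp only [mix, Matrix.mul_apply, Finset.sum_smul, Finset.smul_sum, smul_smul]
  exact Finset.sum_comm

/-- A difference `mix A x i - mix A x k` is the average of `x j - x l` under the product of the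
rows `i` and `k` of `A`, and the diagonal terms `j = l`, of weight at least `δ ^ 2`, vanish. -/
theorem spread_mix_le {A : Matrix ι ι ℝ} {δ : ℝ} (hδ : 0 ≤ δ) (hA : ∀ i j, δ ≤ A i j)
    (hsum : ∀ i, ∑ j, A i j = 1) (x : ι → E) :
    spread (mix A x) ≤ (1 - δ ^ 2) * spread x := by
  classical
  cases isEmpty_or_nonempty ι with
  | inl h =>
    have h0 : ∀ y : ι → E, spread y = 0 := fun y =>
      le_antisymm (spread_le le_rfl fun i => isEmptyElim i) (spread_nonneg _)
    simp [h0]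
  | inr hne =>
  have h0 : ∀ i j, 0 ≤ A i j := fun i j => hδ.trans (hA i j)
  have key : ∀ i k, ‖mix A x i - mix A x k‖ ≤ (1 - δ ^ 2) * spread x := by
    intro i k
    have e : mix A x i - mix A x k = ∑ j, ∑ l, (A i j * A k l) • (x j - x l) := by
      simp only [smul_sub, Finset.sum_sub_distrib, mix]
      congr 1
      · refine Finset.sum_congr rfl fun j _ => ?_
        rw [← Finset.sum_smul, ← Finset.mul_sum, hsum, mul_one]
      · rw [Finset.sum_comm]
        refine Finset.sum_congr rfl fun l _ => ?_
        rw [← Finset.sum_smul, ← Finset.sum_mul, hsum, one_mul]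
    have hterm : ∀ j l, ‖(A i j * A k l) • (x j - x l)‖
        ≤ (A i j * A k l - if j = l then A i j * A k l else 0) * spread x := by
      intro j l
      split_ifs with h
      · simp [h]
      · rw [norm_smul, Real.norm_of_nonneg (mul_nonneg (h0 _ _) (h0 _ _)), sub_zero]
        exact mul_le_mul_of_nonneg_left (norm_sub_le_spread _ _ _) (mul_nonneg (h0 _ _) (h0 _ _))
    have hdiag : δ ^ 2 ≤ ∑ j, A i j * A k j := by
      obtain ⟨j⟩ := hne
      refine le_trans ?_ (Finset.single_le_sum (f := fun j => A i j * A k j)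
        (fun l _ => mul_nonneg (h0 _ _) (h0 _ _)) (Finset.mem_univ j))
      rw [sq]
      exact mul_le_mul (hA _ _) (hA _ _) hδ (h0 _ _)
    calc ‖mix A x i - mix A x k‖
        ≤ ∑ j, ∑ l, (A i j * A k l - if j = l then A i j * A k l else 0) * spread x := by
          rw [e]
          exact (norm_sum_le _ _).trans (Finset.sum_le_sum fun j _ =>
            (norm_sum_le _ _).trans (Finset.sum_le_sum fun l _ => hterm j l))
      _ = (1 - ∑ j, A i j * A k j) * spread x := by
          simp only [← Finset.sum_mul, Finset.sum_sub_distrib, ← Finset.mul_sum, hsum, mul_one,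
            Finset.sum_ite_eq, Finset.mem_univ, if_true]
      _ ≤ _ := mul_le_mul_of_nonneg_right (by linarith) (spread_nonneg _)
  obtain ⟨i⟩ := hne
  exact spread_le ((norm_nonneg _).trans (key i i)) key

variable [DecidableEq ι]

theorem mix_one (x : ι → E) : mix (1 : Matrix ι ι ℝ) x = x := by
  ext i; simp [mix, Matrix.one_apply]

/-- The total spread over the next `T` mixing steps started from `x` at time `ν`. Mixing matrices
with a positive product over `T` steps contract it at every step, whereas the spread itself need
not shrink before all `T` steps are made. -/
def energy (W : ℕ → Matrix ι ι ℝ) (T ν : ℕ) (x : ι → E) : ℝ :=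
  ∑ s ∈ Finset.range T, spread (mix (transition W ν s) x)

theorem energy_nonneg (W : ℕ → Matrix ι ι ℝ) (T ν : ℕ) (x : ι → E) : 0 ≤ energy W T ν x :=
  Finset.sum_nonneg fun _ _ => spread_nonneg _

theorem spread_le_energy (W : ℕ → Matrix ι ι ℝ) {T : ℕ} (hT : 0 < T) (ν : ℕ) (x : ι → E) :
    spread x ≤ energy W T ν x := by
  have h0 : spread (mix (transition W ν 0) x) = spread x := by rw [transition, mix_one]
  exact h0.symm.trans_le (Finset.single_le_sum (f := fun s => spread (mix (transition W ν s) x))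
    (fun s _ => spread_nonneg _) (Finset.mem_range.2 hT))

theorem energy_add_le (W : ℕ → Matrix ι ι ℝ) (T ν : ℕ) (x y : ι → E) :
    energy W T ν (x + y) ≤ energy W T ν x + energy W T ν y := by
  rw [energy, energy, energy, ← Finset.sum_add_distrib]
  exact Finset.sum_le_sum fun s _ => by rw [mix_add]; exact spread_add_le _ _

theorem energy_le {W : ℕ → Matrix ι ι ℝ} (hW : ∀ ν i j, 0 ≤ W ν i j)
    (hsum : ∀ ν i, ∑ j, W ν i j = 1) (T ν : ℕ) (x : ι → E) :
    energy W T ν x ≤ T * spread x := by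
  calc energy W T ν x ≤ ∑ _s ∈ Finset.range T, spread x := Finset.sum_le_sum fun s _ => by
        simpa using spread_mix_le le_rfl (transition_nonneg hW ν s) (transition_row_sum hsum ν s) x
    _ = T * spread x := by simp

theorem energy_mix_le {W : ℕ → Matrix ι ι ℝ} (hW : ∀ ν i j, 0 ≤ W ν i j)
    (hsum : ∀ ν i, ∑ j, W ν i j = 1) {T : ℕ} (hT : 0 < T) {δ : ℝ} (hδ : 0 ≤ δ)
    (hpos : ∀ ν i j, δ ≤ transition W ν T i j) (ν : ℕ) (x : ι → E) :
    energy W T (ν + 1) (mix (W ν) x) ≤ (1 - δ ^ 2 / T) * energy W T ν x := by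
  have e : energy W T (ν + 1) (mix (W ν) x)
      = energy W T ν x - spread x + spread (mix (transition W ν T) x) := by
    have h1 := Finset.sum_range_succ (fun s => spread (mix (transition W ν s) x)) T
    rw [Finset.sum_range_succ'] at h1
    simp only [transition, mix_one, mix_mul] at h1
    rw [energy, energy]
    linarith
  have h1 := spread_mix_le hδ (hpos ν) (transition_row_sum hsum ν T) x
  have h2 := energy_le hW hsum T ν x
  have hT' : (0 : ℝ) < T := by exact_mod_cast hT
  have h3 : δ ^ 2 / T * energy W T ν x ≤ δ ^ 2 * spread x := by
    calc δ ^ 2 / T * energy W T ν x ≤ δ ^ 2 / T * (T * spread x) :=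
          mul_le_mul_of_nonneg_left h2 (by positivity)
      _ = δ ^ 2 * spread x := by field_simp
  rw [e]
  linarith

theorem energy_mix_add_le {W : ℕ → Matrix ι ι ℝ} (hW : ∀ ν i j, 0 ≤ W ν i j)
    (hsum : ∀ ν i, ∑ j, W ν i j = 1) {T : ℕ} (hT : 0 < T) {δ : ℝ} (hδ : 0 ≤ δ) (hδ1 : δ ≤ 1)
    (hpos : ∀ ν i j, δ ≤ transition W ν T i j) (ν : ℕ) (x e : ι → E) :
    energy W T (ν + 1) (mix (W ν) (x + e)) ≤ (1 - δ ^ 2 / T) * energy W T ν x + 2 * T * ‖e‖ := by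
  have hT' : (1 : ℝ) ≤ T := by exact_mod_cast hT
  have hρ0 : 0 ≤ 1 - δ ^ 2 / T := by
    rw [sub_nonneg, div_le_one (by linarith)]
    nlinarith
  have hρ1 : 1 - δ ^ 2 / T ≤ 1 := by
    have : 0 ≤ δ ^ 2 / T := by positivity
    linarith
  have he : energy W T ν e ≤ 2 * T * ‖e‖ := by
    have h1 := energy_le hW hsum T ν e
    have h2 := spread_le_two_mul_norm e
    nlinarith
  calc energy W T (ν + 1) (mix (W ν) (x + e))
      ≤ (1 - δ ^ 2 / T) * energy W T ν (x + e) := energy_mix_le hW hsum hT hδ hpos ν _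
    _ ≤ (1 - δ ^ 2 / T) * (energy W T ν x + energy W T ν e) :=
        mul_le_mul_of_nonneg_left (energy_add_le _ _ _ _ _) hρ0
    _ ≤ _ := by nlinarith [energy_nonneg W T ν e]

end Spread

/-! ### First-order inequalities for convex functions -/

section FirstOrder

open Filter Topology

theorem le_deriv_of_eventually_le {h : ℝ → ℝ} {a b c : ℝ} (hd : HasDerivAt h a 0)
    (hle : ∀ᶠ t in 𝓝[>] (0 : ℝ), t * b - t ^ 2 * c ≤ h t - h 0) : b ≤ a := by
  have h1 := hd.tendsto_slope_zero_right
  have h2 : Tendsto (fun t : ℝ => b - t * c) (𝓝[>] 0) (𝓝 b) := by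
    have : Continuous fun t : ℝ => b - t * c := by fun_prop
    simpa using (this.tendsto 0).mono_left nhdsWithin_le_nhds
  refine le_of_tendsto_of_tendsto h2 h1 ?_
  filter_upwards [hle, self_mem_nhdsWithin] with t ht ht0
  have ht0 : 0 < t := ht0
  rw [smul_eq_mul, zero_add, inv_mul_eq_div, le_div_iff₀ ht0]
  linarith

variable {E : Type*} [NormedAddCommGroup E] [InnerProductSpace ℝ E] [CompleteSpace E]

theorem eventually_pos_le_one : ∀ᶠ t in 𝓝[>] (0 : ℝ), 0 < t ∧ t ≤ 1 := by
  filter_upwards [Ioc_mem_nhdsGT (zero_lt_one' ℝ)] with t ht using ht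

theorem hasDerivAt_comp_line {g : E → ℝ} {g' x v : E} {t : ℝ} (hg : HasGradientAt g g' (x + t • v)) :
    HasDerivAt (fun s : ℝ => g (x + s • v)) (inner ℝ g' v) t := by
  have hl : HasDerivAt (fun s : ℝ => x + s • v) v t := by
    simpa using ((hasDerivAt_id t).smul_const v).const_add x
  have h := hg.hasFDerivAt.comp_hasDerivAt t hl
  rw [InnerProductSpace.toDual_apply_apply] at h
  exact h

theorem add_inner_add_le_of_strongConvexOn {K : Set E} {g : E → ℝ} {μ : ℝ}
    (hg : StrongConvexOn K μ g) {x z g' : E} (hx : x ∈ K) (hz : z ∈ K) (hd : HasGradientAt g g' x) :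
    g x + inner ℝ g' (z - x) + μ / 2 * ‖z - x‖ ^ 2 ≤ g z := by
  have h1 : HasDerivAt (fun s : ℝ => g (x + s • (z - x))) (inner ℝ g' (z - x)) 0 :=
    hasDerivAt_comp_line (by simpa using hd)
  have h2 := le_deriv_of_eventually_le (b := -(g z - g x - μ / 2 * ‖z - x‖ ^ 2))
    (c := μ / 2 * ‖z - x‖ ^ 2) h1.neg ?_
  · linarith
  filter_upwards [eventually_pos_le_one] with t ht
  have h3 := hg.2 hx hz (sub_nonneg.2 ht.2) ht.1.le (by ring)
  have e : (1 - t) • x + t • z = x + t • (z - x) := by module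
  rw [e, norm_sub_rev] at h3
  simp only [smul_eq_mul] at h3
  simp only [Pi.neg_apply, zero_smul, add_zero]
  nlinarith

theorem inner_sub_ge_of_strongConvexOn {K : Set E} {g : E → ℝ} {μ : ℝ}
    (hg : StrongConvexOn K μ g) {x z gx gz : E} (hx : x ∈ K) (hz : z ∈ K)
    (hdx : HasGradientAt g gx x) (hdz : HasGradientAt g gz z) :
    μ * ‖z - x‖ ^ 2 ≤ inner ℝ (gz - gx) (z - x) := by
  have h1 := add_inner_add_le_of_strongConvexOn hg hx hz hdx
  have h2 := add_inner_add_le_of_strongConvexOn hg hz hx hdz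
  rw [← neg_sub z x, norm_neg, inner_neg_right] at h2
  rw [inner_sub_left]
  linarith

/-- First-order optimality for a composite objective `g + G` with `g` differentiable and `G` merely
convex. -/
theorem inner_add_sub_nonneg_of_isMinOn {K : Set E} {g G : E → ℝ} (hG : ConvexOn ℝ K G) {x z g' : E}
    (hmin : IsMinOn (fun w => g w + G w) K x) (hx : x ∈ K) (hz : z ∈ K) (hd : HasGradientAt g g' x) :
    0 ≤ inner ℝ g' (z - x) + G z - G x := by
  have h1 : HasDerivAt (fun s : ℝ => g (x + s • (z - x))) (inner ℝ g' (z - x)) 0 :=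
    hasDerivAt_comp_line (by simpa using hd)
  have h2 := le_deriv_of_eventually_le (b := G x - G z) (c := 0) h1 ?_
  · linarith
  filter_upwards [eventually_pos_le_one] with t ht
  have h3 := hG.2 hx hz (sub_nonneg.2 ht.2) ht.1.le (by ring)
  have h4 := hmin (hG.1 hx hz (sub_nonneg.2 ht.2) ht.1.le (by ring))
  have e : (1 - t) • x + t • z = x + t • (z - x) := by module
  simp only [e, smul_eq_mul, Set.mem_ofPred_eq] at h3 h4
  simp only [zero_smul, add_zero]
  nlinarith

end FirstOrder

/-! ### Second-order bounds -/

section SecondOrder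

theorem taylor_lower_of_le_deriv2 {h h' h'' : ℝ → ℝ} {a : ℝ}
    (hd : ∀ t ∈ Set.Icc (0 : ℝ) 1, HasDerivAt h (h' t) t)
    (hd' : ∀ t ∈ Set.Icc (0 : ℝ) 1, HasDerivAt h' (h'' t) t)
    (ha : ∀ t ∈ Set.Icc (0 : ℝ) 1, a ≤ h'' t) : h 0 + h' 0 + a / 2 ≤ h 1 := by
  have mono : ∀ g g' : ℝ → ℝ, (∀ t ∈ Set.Icc (0 : ℝ) 1, HasDerivAt g (g' t) t) →
      (∀ t ∈ Set.Icc (0 : ℝ) 1, 0 ≤ g' t) → MonotoneOn g (Set.Icc 0 1) := by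
    intro g g' hg hg'
    refine monotoneOn_of_deriv_nonneg (convex_Icc 0 1)
      (fun t ht => (hg t ht).continuousAt.continuousWithinAt)
      (fun t ht => (hg t (interior_subset ht)).differentiableAt.differentiableWithinAt)
      fun t ht => ?_
    rw [(hg t (interior_subset ht)).deriv]
    exact hg' t (interior_subset ht)
  have m1 : MonotoneOn (fun t => h' t - a * t) (Set.Icc 0 1) :=
    mono _ (fun t => h'' t - a)
      (fun t ht => ((hd' t ht).sub ((hasDerivAt_id t).const_mul a)).congr_deriv (by simp))
      fun t ht => sub_nonneg.2 (ha t ht)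
  have m2 : MonotoneOn (fun t => h t - h' 0 * t - a / 2 * t ^ 2) (Set.Icc 0 1) := by
    refine mono _ (fun t => h' t - h' 0 - a * t) (fun t ht => ?_) fun t ht => ?_
    · have := ((hd t ht).sub ((hasDerivAt_id t).const_mul (h' 0))).sub
        ((hasDerivAt_pow 2 t).const_mul (a / 2))
      refine this.congr_deriv ?_
      norm_num
      ring
    · have := m1 (Set.left_mem_Icc.2 zero_le_one) ht ht.1
      simp only [mul_zero, sub_zero] at this
      linarith
  have := m2 (Set.left_mem_Icc.2 zero_le_one) (Set.right_mem_Icc.2 zero_le_one) zero_le_one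
  norm_num at this
  linarith

variable {d : ℕ}

theorem hasDerivAt_inner_gradient_line {g : Vec d → ℝ} {x v : Vec d} {t : ℝ}
    (hg : DifferentiableAt ℝ (gradient g) (x + t • v)) :
    HasDerivAt (fun s : ℝ => inner ℝ (gradient g (x + s • v)) v) (hessForm g (x + t • v) v) t := by
  have hl : HasDerivAt (fun s : ℝ => x + s • v) v t := by
    simpa using ((hasDerivAt_id t).smul_const v).const_add x
  have h1 := hg.hasFDerivAt.comp_hasDerivAt t hl
  simpa [hessForm, hess] using h1.inner ℝ (hasDerivAt_const t v)

/-- A lower bound of the Hessian on a convex set gives the quadratic lower bound of first order. -/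
theorem add_inner_add_le_of_le_hessForm {K : Set (Vec d)} (hK : Convex ℝ K) {g : Vec d → ℝ} {a : ℝ}
    (hd : ∀ x ∈ K, DifferentiableAt ℝ g x) (hd' : ∀ x ∈ K, DifferentiableAt ℝ (gradient g) x)
    (ha : ∀ x ∈ K, ∀ u, a * ‖u‖ ^ 2 ≤ hessForm g x u) {x z : Vec d} (hx : x ∈ K) (hz : z ∈ K) :
    g x + inner ℝ (gradient g x) (z - x) + a / 2 * ‖z - x‖ ^ 2 ≤ g z := by
  have hmem : ∀ t ∈ Set.Icc (0 : ℝ) 1, x + t • (z - x) ∈ K := fun t ht => by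
    have e : (1 - t) • x + t • z = x + t • (z - x) := by module
    exact e ▸ hK hx hz (sub_nonneg.2 ht.2) ht.1 (by ring)
  have := taylor_lower_of_le_deriv2 (fun t ht => hasDerivAt_comp_line (hd _ (hmem t ht)).hasGradientAt)
    (fun t ht => hasDerivAt_inner_gradient_line (hd' _ (hmem t ht)))
    (fun t ht => ha _ (hmem t ht) (z - x))
  simp only [zero_smul, add_zero, one_smul, add_sub_cancel] at this
  linarith

theorem gradient_neg_eq (g : Vec d → ℝ) : gradient (fun x => -g x) = fun x => -gradient g x := by
  ext1 x
  rw [gradient, fderiv_fun_neg, map_neg, ← gradient]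

theorem le_add_inner_add_of_hessForm_le {K : Set (Vec d)} (hK : Convex ℝ K) {g : Vec d → ℝ} {a : ℝ}
    (hd : ∀ x ∈ K, DifferentiableAt ℝ g x) (hd' : ∀ x ∈ K, DifferentiableAt ℝ (gradient g) x)
    (ha : ∀ x ∈ K, ∀ u, hessForm g x u ≤ a * ‖u‖ ^ 2) {x z : Vec d} (hx : x ∈ K) (hz : z ∈ K) :
    g z ≤ g x + inner ℝ (gradient g x) (z - x) + a / 2 * ‖z - x‖ ^ 2 := by
  have := add_inner_add_le_of_le_hessForm (a := -a) hK (g := fun x => -g x)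
    (fun x hx => (hd x hx).neg) (fun x hx => by rw [gradient_neg_eq]; exact (hd' x hx).neg)
    (fun x hx u => by
      rw [hessForm, hess, gradient_neg_eq, fderiv_fun_neg, neg_apply, inner_neg_left]
      have := ha x hx u
      rw [hessForm, hess] at this
      linarith) hx hz
  rw [gradient_neg_eq, inner_neg_left] at this
  linarith

theorem hessForm_nonneg_of_convexOn {O : Set (Vec d)} (hO : IsOpen O) {g : Vec d → ℝ}
    (hg : ConvexOn ℝ O g) (hd : DifferentiableOn ℝ g O) (hd' : DifferentiableOn ℝ (gradient g) O)
    {x : Vec d} (hx : x ∈ O) (u : Vec d) : 0 ≤ hessForm g x u := by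
  have hgrad : ∀ y ∈ O, HasGradientAt g (gradient g y) y := fun y hy =>
    (hd.differentiableAt (hO.mem_nhds hy)).hasGradientAt
  have h1 := hasDerivAt_inner_gradient_line (g := g) (x := x) (v := u) (t := 0)
    (by simpa using hd'.differentiableAt (hO.mem_nhds hx))
  rw [zero_smul, add_zero] at h1
  refine le_deriv_of_eventually_le (c := 0) h1 ?_
  have hcont : Continuous fun t : ℝ => x + t • u := by fun_prop
  have hmem := (hcont.tendsto' 0 x (by simp)).eventually (hO.mem_nhds hx)
  filter_upwards [nhdsWithin_le_nhds hmem, self_mem_nhdsWithin] with t ht ht0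
  have ht0 : 0 < t := ht0
  have h2 := inner_sub_ge_of_strongConvexOn (strongConvexOn_zero.2 hg) hx ht (hgrad x hx) (hgrad _ ht)
  rw [add_sub_cancel_left, inner_smul_right, zero_mul] at h2
  have h3 := nonneg_of_mul_nonneg_right h2 ht0
  rw [inner_sub_left] at h3
  simpa using h3

theorem inner_hess_comm {O : Set (Vec d)} (hO : IsOpen O) {g : Vec d → ℝ}
    (hd : DifferentiableOn ℝ g O) (hd' : DifferentiableOn ℝ (gradient g) O)
    {x : Vec d} (hx : x ∈ O) (u v : Vec d) :
    inner ℝ (hess g x u) v = inner ℝ (hess g x v) u := by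
  let D := (InnerProductSpace.toDual ℝ (Vec d)).toContinuousLinearEquiv.toContinuousLinearMap
  have h1 : ∀ᶠ y in nhds x, HasFDerivAt g (D (gradient g y)) y := by
    filter_upwards [hO.mem_nhds hx] with y hy
    exact ((hd.differentiableAt (hO.mem_nhds hy)).hasGradientAt).hasFDerivAt
  have h2 : HasFDerivAt (fun y => D (gradient g y)) (D ∘L hess g x) x :=
    D.hasFDerivAt.comp x (hd'.differentiableAt (hO.mem_nhds hx)).hasFDerivAt
  simpa [D] using second_derivative_symmetric_of_eventually h1 h2 u v

/-- By polarization, a symmetric nonnegative form bounded by `M ‖u‖ ^ 2` comes from an operator of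
norm at most `M`. -/
theorem norm_apply_le_of_inner_le {H : Vec d →L[ℝ] Vec d} {M : ℝ}
    (hsymm : ∀ u v, inner ℝ (H u) v = inner ℝ (H v) u) (h0 : ∀ u, 0 ≤ inner ℝ (H u) u)
    (hM : ∀ u, inner ℝ (H u) u ≤ M * ‖u‖ ^ 2) (u : Vec d) : ‖H u‖ ≤ M * ‖u‖ := by
  have hsum : ∀ a b : Vec d, 2 * inner ℝ (H a) b ≤ M * (‖a‖ ^ 2 + ‖b‖ ^ 2) := by
    intro a b
    have h1 := hM (a + b)
    have h2 := h0 (a - b)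
    have h3 := hM (a - b)
    have h4 := h0 (a + b)
    have h5 := parallelogram_law_with_norm ℝ a b
    simp only [map_add, map_sub, inner_add_left, inner_add_right, inner_sub_left, inner_sub_right,
      hsymm b a] at h1 h2 h3 h4
    have h6 : M * ‖a + b‖ ^ 2 + M * ‖a - b‖ ^ 2 = 2 * M * (‖a‖ ^ 2 + ‖b‖ ^ 2) := by
      linear_combination M * h5
    linarith
  rcases eq_or_ne u 0 with rfl | hu
  · simp
  rcases eq_or_ne (H u) 0 with hH | hH
  · have h1 := (h0 u).trans (hM u)
    have hu' := norm_pos_iff.2 hu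
    rw [hH, norm_zero]
    have : 0 ≤ M := nonneg_of_mul_nonneg_left h1 (by positivity)
    positivity
  have hu' := norm_pos_iff.2 hu
  have hH' := norm_pos_iff.2 hH
  have h1 := hsum u ((‖u‖ / ‖H u‖) • H u)
  rw [inner_smul_right, real_inner_self_eq_norm_sq, norm_smul, Real.norm_of_nonneg (by positivity),
    div_mul_cancel₀ _ hH'.ne'] at h1
  have e : ‖u‖ / ‖H u‖ * ‖H u‖ ^ 2 = ‖u‖ * ‖H u‖ := by field_simp
  rw [e] at h1
  refine le_of_mul_le_mul_left ?_ hu'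
  nlinarith

theorem norm_gradient_sub_le {K O : Set (Vec d)} (hK : Convex ℝ K) (hO : IsOpen O) (hKO : K ⊆ O)
    {g : Vec d → ℝ} (hg : ConvexOn ℝ O g) (hd : DifferentiableOn ℝ g O)
    (hd' : DifferentiableOn ℝ (gradient g) O) {M : ℝ} (hM0 : 0 ≤ M)
    (hM : ∀ x ∈ K, ∀ u, hessForm g x u ≤ M * ‖u‖ ^ 2) {x z : Vec d} (hx : x ∈ K) (hz : z ∈ K) :
    ‖gradient g z - gradient g x‖ ≤ M * ‖z - x‖ := by
  refine hK.norm_image_sub_le_of_norm_hasFDerivWithin_le (f' := hess g) (fun y hy =>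
    ((hd'.differentiableAt (hO.mem_nhds (hKO hy))).hasFDerivAt).hasFDerivWithinAt) (fun y hy => ?_)
    hx hz
  exact ContinuousLinearMap.opNorm_le_bound _ hM0 fun u => norm_apply_le_of_inner_le
    (inner_hess_comm hO hd hd' (hKO hy))
    (hessForm_nonneg_of_convexOn hO hg hd hd' (hKO hy)) (hM y hy) u

end SecondOrder

/-! ### Consequences of the assumptions on the problem -/

section Problem

variable {m d : ℕ} {K O : Set (Vec d)} {f : Fin m → Vec d → ℝ} {G : Vec d → ℝ} {μ L : ℝ}

theorem ProblemAssumption.hasGradientAt (hP : ProblemAssumption K O f G μ L) (i : Fin m) {x : Vec d}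
    (hx : x ∈ O) : HasGradientAt (f i) (gradient (f i) x) x :=
  ((hP.loss_differentiable i).differentiableAt (hP.isOpen.mem_nhds hx)).hasGradientAt

theorem ProblemAssumption.hasGradientAt_avgLoss (hP : ProblemAssumption K O f G μ L) {x : Vec d}
    (hx : x ∈ O) :
    HasGradientAt (avgLoss f) ((1 / (m : ℝ)) • ∑ i, gradient (f i) x) x := by
  have h1 := (HasFDerivAt.fun_sum (u := Finset.univ)
    fun i _ => (hP.hasGradientAt i hx).hasFDerivAt).const_mul (1 / (m : ℝ))
  rw [hasGradientAt_iff_hasFDerivAt, map_smul, map_sum]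
  exact h1

theorem ProblemAssumption.gradient_avgLoss (hP : ProblemAssumption K O f G μ L) {x : Vec d}
    (hx : x ∈ O) : gradient (avgLoss f) x = (1 / (m : ℝ)) • ∑ i, gradient (f i) x :=
  (hP.hasGradientAt_avgLoss hx).gradient

theorem ProblemAssumption.hasFDerivAt_gradient_avgLoss (hP : ProblemAssumption K O f G μ L)
    {x : Vec d} (hx : x ∈ O) :
    HasFDerivAt (gradient (avgLoss f)) ((1 / (m : ℝ)) • ∑ i, hess (f i) x) x := by
  have h1 := (HasFDerivAt.fun_sum (u := Finset.univ) fun i _ =>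
    ((hP.loss_twice_differentiable i).differentiableAt (hP.isOpen.mem_nhds hx)).hasFDerivAt).const_smul
      (1 / (m : ℝ))
  refine h1.congr_of_eventuallyEq ?_
  filter_upwards [hP.isOpen.mem_nhds hx] with y hy using hP.gradient_avgLoss hy

/-- Each summand of the Hessian of `F` is nonnegative, so it is bounded by the whole sum. -/
theorem ProblemAssumption.hessForm_le (hP : ProblemAssumption K O f G μ L) (i : Fin m)
    {x : Vec d} (hx : x ∈ K) (u : Vec d) : hessForm (f i) x u ≤ m * L * ‖u‖ ^ 2 := by
  have hm : (0 : ℝ) < m := by exact_mod_cast i.pos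
  have h1 := hP.hess_upper x hx u
  have h2 : hessForm (avgLoss f) x u = 1 / m * ∑ j, hessForm (f j) x u := by
    rw [hessForm, hess, (hP.hasFDerivAt_gradient_avgLoss (hP.subset hx)).fderiv]
    simp [hessForm, inner_smul_left, sum_inner]
  have h3 : hessForm (f i) x u ≤ ∑ j, hessForm (f j) x u :=
    Finset.single_le_sum (f := fun j => hessForm (f j) x u) (fun j _ =>
      hessForm_nonneg_of_convexOn hP.isOpen (hP.loss_convex j) (hP.loss_differentiable j)
        (hP.loss_twice_differentiable j) (hP.subset hx) u) (Finset.mem_univ i)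
  rw [h2, one_div, inv_mul_le_iff₀ hm] at h1
  linarith

theorem ProblemAssumption.norm_gradient_sub_le (hP : ProblemAssumption K O f G μ L) (i : Fin m)
    {x z : Vec d} (hx : x ∈ K) (hz : z ∈ K) :
    ‖gradient (f i) z - gradient (f i) x‖ ≤ m * L * ‖z - x‖ :=
  Sonata.norm_gradient_sub_le hP.convex hP.isOpen hP.subset (hP.loss_convex i) (hP.loss_differentiable i)
    (hP.loss_twice_differentiable i) (mul_nonneg (Nat.cast_nonneg m) hP.L_pos.le)
    (fun _ hy => hP.hessForm_le i hy) hx hz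

theorem norm_average_le (hm : 0 < m) {v : Fin m → Vec d} {r : ℝ} (h : ∀ i, ‖v i‖ ≤ r) :
    ‖(1 / (m : ℝ)) • ∑ i, v i‖ ≤ r := by
  have hm' : (0 : ℝ) < m := by exact_mod_cast hm
  rw [norm_smul, Real.norm_of_nonneg (by positivity), one_div, inv_mul_le_iff₀ hm']
  calc ‖∑ i, v i‖ ≤ ∑ i, ‖v i‖ := norm_sum_le _ _
    _ ≤ ∑ _i : Fin m, r := Finset.sum_le_sum fun i _ => h i
    _ = m * r := by simp

theorem ProblemAssumption.norm_gradient_avgLoss_sub_le (hP : ProblemAssumption K O f G μ L)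
    (hm : 0 < m) {x z : Vec d} (hx : x ∈ K) (hz : z ∈ K) :
    ‖gradient (avgLoss f) z - gradient (avgLoss f) x‖ ≤ m * L * ‖z - x‖ := by
  rw [hP.gradient_avgLoss (hP.subset hx), hP.gradient_avgLoss (hP.subset hz), ← smul_sub,
    ← Finset.sum_sub_distrib]
  exact norm_average_le hm fun i => hP.norm_gradient_sub_le i hx hz

theorem ProblemAssumption.avgLoss_lower (hP : ProblemAssumption K O f G μ L) {x z : Vec d}
    (hx : x ∈ K) (hz : z ∈ K) :
    avgLoss f x + inner ℝ (gradient (avgLoss f) x) (z - x) + μ / 2 * ‖z - x‖ ^ 2 ≤ avgLoss f z :=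
  add_inner_add_le_of_le_hessForm hP.convex
    (fun _ hy => (hP.hasGradientAt_avgLoss (hP.subset hy)).differentiableAt)
    (fun _ hy => (hP.hasFDerivAt_gradient_avgLoss (hP.subset hy)).differentiableAt)
    hP.hess_lower hx hz

theorem ProblemAssumption.avgLoss_upper (hP : ProblemAssumption K O f G μ L) {x z : Vec d}
    (hx : x ∈ K) (hz : z ∈ K) :
    avgLoss f z ≤ avgLoss f x + inner ℝ (gradient (avgLoss f) x) (z - x) + L / 2 * ‖z - x‖ ^ 2 :=
  le_add_inner_add_of_hessForm_le hP.convex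
    (fun _ hy => (hP.hasGradientAt_avgLoss (hP.subset hy)).differentiableAt)
    (fun _ hy => (hP.hasFDerivAt_gradient_avgLoss (hP.subset hy)).differentiableAt)
    hP.hess_upper hx hz

theorem ProblemAssumption.convexOn_objective (hP : ProblemAssumption K O f G μ L) :
    ConvexOn ℝ K (objective f G) := by
  have h1 : ConvexOn ℝ K (fun x => ∑ i, f i x) := by
    refine ⟨hP.convex, fun x hx z hz a b ha hb hab => ?_⟩
    simp only [smul_eq_mul, Finset.mul_sum, ← Finset.sum_add_distrib]
    exact Finset.sum_le_sum fun i _ => (hP.loss_convex i).2 (hP.subset hx) (hP.subset hz) ha hb hab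
  exact (h1.smul (c := 1 / (m : ℝ)) (by positivity)).add hP.reg_convex

end Problem

/-! ### Descent in one local step -/

section LocalStep

variable {m d : ℕ} {K O : Set (Vec d)} {f : Fin m → Vec d → ℝ} {G : Vec d → ℝ} {μ L : ℝ}
  {ft : Fin m → Vec d → Vec d → ℝ} {μt Lt : Fin m → ℝ}

theorem SurrogateAssumption.hasGradientAt (hS : SurrogateAssumption K O f ft μt Lt) (hO : IsOpen O)
    (i : Fin m) {x z : Vec d} (hx : x ∈ O) (hz : z ∈ O) :
    HasGradientAt (fun w => ft i w x) (gradient (fun w => ft i w x) z) z := by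
  have h1 : DifferentiableAt ℝ (fun p : Vec d × Vec d => ft i p.1 p.2) (z, x) :=
    ((hS.contDiff i).differentiableOn (by norm_num)).differentiableAt
      ((hO.prod hO).mem_nhds ⟨hz, hx⟩)
  have h2 : DifferentiableAt ℝ (fun w : Vec d => (w, x)) z := by fun_prop
  exact (DifferentiableAt.comp z h1 h2).hasGradientAt

/-- `xh` minimizes over `K` the subproblem of agent `i` at the iterate `x` with gradient
estimate `y`. -/
def IsBestResponse (K : Set (Vec d)) (f : Fin m → Vec d → ℝ) (ft : Fin m → Vec d → Vec d → ℝ)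
    (G : Vec d → ℝ) (i : Fin m) (x y xh : Vec d) : Prop :=
  IsMinOn (fun z => ft i z x + inner ℝ (y - gradient (f i) x) (z - x) + G z) K xh

variable {i : Fin m} {x y xh : Vec d}

theorem IsBestResponse.inner_nonneg (hP : ProblemAssumption K O f G μ L)
    (hS : SurrogateAssumption K O f ft μt Lt) (h : IsBestResponse K f ft G i x y xh)
    (hx : x ∈ K) (hxh : xh ∈ K) {z : Vec d} (hz : z ∈ K) :
    0 ≤ inner ℝ (gradient (fun w => ft i w x) xh - gradient (fun w => ft i w x) x + y) (z - xh)
      + G z - G xh := by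
  have h1 := hS.hasGradientAt hP.isOpen i (hP.subset hx) (hP.subset hxh)
  have h2 : HasGradientAt (fun w => inner ℝ (y - gradient (f i) x) (w - x))
      (y - gradient (f i) x) xh := by
    generalize y - gradient (f i) x = q
    rw [hasGradientAt_iff_hasFDerivAt]
    have := ((InnerProductSpace.toDual ℝ (Vec d) q).hasFDerivAt (x := xh - x)).comp
      xh ((hasFDerivAt_id xh).sub_const x)
    simpa [Function.comp_def] using this
  have h3 : HasGradientAt
      (fun w => ft i w x + inner ℝ (y - gradient (f i) x) (w - x))
      (gradient (fun w => ft i w x) xh + (y - gradient (f i) x)) xh := by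
    rw [hasGradientAt_iff_hasFDerivAt, map_add]
    exact h1.hasFDerivAt.add h2.hasFDerivAt
  have h4 := inner_add_sub_nonneg_of_isMinOn hP.reg_convex h hxh hz h3
  rw [hS.gradient_eq i x hx]
  convert h4 using 4
  abel

theorem IsBestResponse.inner_add_sub_le (hP : ProblemAssumption K O f G μ L)
    (hS : SurrogateAssumption K O f ft μt Lt) (h : IsBestResponse K f ft G i x y xh)
    (hx : x ∈ K) (hxh : xh ∈ K) :
    inner ℝ y (xh - x) + G xh - G x ≤ -(μt i * ‖xh - x‖ ^ 2) := by
  have h1 := h.inner_nonneg hP hS hx hxh hx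
  have h2 := inner_sub_ge_of_strongConvexOn (hS.strongConvex i x hx) hx hxh
    (hS.hasGradientAt hP.isOpen i (hP.subset hx) (hP.subset hx))
    (hS.hasGradientAt hP.isOpen i (hP.subset hx) (hP.subset hxh))
  rw [← neg_sub xh x, inner_neg_right, inner_add_left] at h1
  linarith

/-- The suboptimality of the best response is controlled by the length of the step and the error of
the gradient estimate. Comparing with every `z ∈ K` instead of a minimizer of `U` matters: `G` need
not be lower semicontinuous, so `U` may have no minimizer on `K`. -/
theorem IsBestResponse.objective_sub_le (hP : ProblemAssumption K O f G μ L)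
    (hS : SurrogateAssumption K O f ft μt Lt) (h : IsBestResponse K f ft G i x y xh)
    (hx : x ∈ K) (hxh : xh ∈ K) {z : Vec d} (hz : z ∈ K) {Λ : ℝ} (hΛ : Lt i ≤ Λ) (hΛ0 : 0 ≤ Λ) :
    objective f G xh - objective f G z ≤ (m * L + Λ + 1) ^ 2 / μ *
      (‖xh - x‖ ^ 2 + ‖gradient (avgLoss f) x - y‖ ^ 2) := by
  have hμ := hP.mu_pos
  have h1 := h.inner_nonneg hP hS hx hxh hz
  have h2 := hP.avgLoss_lower hxh hz
  set e := ‖gradient (avgLoss f) x - y‖ with he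
  set D := ‖xh - x‖
  set R := gradient (avgLoss f) xh - (gradient (fun w => ft i w x) xh
    - gradient (fun w => ft i w x) x + y) with hR
  have hM : 0 ≤ m * L := mul_nonneg (Nat.cast_nonneg m) hP.L_pos.le
  have hRle : ‖R‖ ≤ (m * L + Λ) * D + e := by
    have e1 : R = (gradient (avgLoss f) xh - gradient (avgLoss f) x)
        - (gradient (fun w => ft i w x) xh - gradient (fun w => ft i w x) x)
        + (gradient (avgLoss f) x - y) := by rw [hR]; abel
    have a1 := hP.norm_gradient_avgLoss_sub_le i.pos hx hxh
    have a2 := (hS.gradient_lipschitz i x hx xh hxh x hx).trans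
      (mul_le_mul_of_nonneg_right hΛ (norm_nonneg _))
    rw [e1]
    refine (norm_add_le _ _).trans (add_le_add ((norm_sub_le _ _).trans ?_) le_rfl)
    rw [add_mul]
    exact add_le_add a1 a2
  have h3 : inner ℝ R (z - xh) ≥ -(‖R‖ * ‖z - xh‖) :=
    neg_le_of_abs_le (abs_real_inner_le_norm _ _)
  rw [hR, inner_sub_left] at h3
  have h4 : ‖R‖ * ‖z - xh‖ ≤ ‖R‖ ^ 2 / (2 * μ) + μ / 2 * ‖z - xh‖ ^ 2 := by
    have e1 : ‖R‖ ^ 2 / (2 * μ) + μ / 2 * ‖z - xh‖ ^ 2 - ‖R‖ * ‖z - xh‖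
        = (‖R‖ - μ * ‖z - xh‖) ^ 2 / (2 * μ) := by field_simp; ring
    have : 0 ≤ (‖R‖ - μ * ‖z - xh‖) ^ 2 / (2 * μ) := by positivity
    linarith
  have h5 : ‖R‖ ^ 2 / (2 * μ) ≤ (m * L + Λ + 1) ^ 2 / μ * (D ^ 2 + e ^ 2) := by
    have hD : 0 ≤ D := norm_nonneg _
    have he0 : 0 ≤ e := norm_nonneg _
    have a1 : ‖R‖ ≤ (m * L + Λ + 1) * (D + e) := by nlinarith
    have a2 : ‖R‖ ^ 2 ≤ (m * L + Λ + 1) ^ 2 * (2 * (D ^ 2 + e ^ 2)) := by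
      calc ‖R‖ ^ 2 ≤ ((m * L + Λ + 1) * (D + e)) ^ 2 := by gcongr
        _ = (m * L + Λ + 1) ^ 2 * (D + e) ^ 2 := by ring
        _ ≤ _ := by gcongr; nlinarith [sq_nonneg (D - e)]
    calc ‖R‖ ^ 2 / (2 * μ) ≤ (m * L + Λ + 1) ^ 2 * (2 * (D ^ 2 + e ^ 2)) / (2 * μ) := by gcongr
      _ = _ := by field_simp
  rw [objective, objective]
  linarith

theorem IsBestResponse.bddBelow (hP : ProblemAssumption K O f G μ L)
    (hS : SurrogateAssumption K O f ft μt Lt) (h : IsBestResponse K f ft G i x y xh)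
    (hx : x ∈ K) (hxh : xh ∈ K) : BddBelow (objective f G '' K) := by
  refine ⟨objective f G xh - (m * L + |Lt i| + 1) ^ 2 / μ *
      (‖xh - x‖ ^ 2 + ‖gradient (avgLoss f) x - y‖ ^ 2), ?_⟩
  rintro _ ⟨z, hz, rfl⟩
  linarith [h.objective_sub_le hP hS hx hxh hz (le_abs_self _) (abs_nonneg (Lt i))]

/-- A damped step towards the best response decreases `U` by a multiple of the squared step, because
of the strong convexity of the surrogate, and by convexity also moves `U` towards its value at the
best response. The convex combination of both bounds with weight `θ` gives a linear contraction of
the optimality gap that keeps a negative multiple of the squared step. -/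
theorem IsBestResponse.objective_step_le (hP : ProblemAssumption K O f G μ L)
    (hS : SurrogateAssumption K O f ft μt Lt) (h : IsBestResponse K f ft G i x y xh)
    (hx : x ∈ K) (hxh : xh ∈ K) {Λ μ₀ A θ α : ℝ} (hΛ : Lt i ≤ Λ) (hΛ0 : 0 ≤ Λ) (hμ₀ : 0 < μ₀)
    (hμt : μ₀ ≤ μt i) (hA : A = (m * L + Λ + 1) ^ 2 / μ) (hθ0 : 0 < θ) (hθ1 : θ ≤ 1 / 4)
    (hθA : θ * A ≤ μ₀ / 4) (hα0 : 0 < α) (hα1 : α ≤ 1) (hαL : α * L ≤ μ₀ / 2) :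
    objective f G (x + α • (xh - x)) - optValue K f G
      ≤ (1 - θ * α) * (objective f G x - optValue K f G) - α * (μ₀ / 8) * ‖xh - x‖ ^ 2
        + α * (A + 1 / μ₀) * ‖gradient (avgLoss f) x - y‖ ^ 2 := by
  have hxα : x + α • (xh - x) ∈ K := by
    have e : (1 - α) • x + α • xh = x + α • (xh - x) := by module
    exact e ▸ hP.convex hx hxh (sub_nonneg.2 hα1) hα0.le (by ring)
  have hA0 : 0 ≤ A := by rw [hA]; have := hP.mu_pos; positivity
  have hopt : objective f G xh - optValue K f G
      ≤ A * (‖xh - x‖ ^ 2 + ‖gradient (avgLoss f) x - y‖ ^ 2) := by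
    have : objective f G xh - A * (‖xh - x‖ ^ 2 + ‖gradient (avgLoss f) x - y‖ ^ 2)
        ≤ optValue K f G := by
      refine le_csInf (hP.nonempty.image _) ?_
      rintro _ ⟨z, hz, rfl⟩
      have := h.objective_sub_le hP hS hx hxh hz hΛ hΛ0
      rw [← hA] at this
      linarith
    linarith
  have hconv : objective f G (x + α • (xh - x))
      ≤ (1 - α) * objective f G x + α * objective f G xh := by
    have e : (1 - α) • x + α • xh = x + α • (xh - x) := by module
    exact e ▸ hP.convexOn_objective.2 hx hxh (sub_nonneg.2 hα1) hα0.le (by ring)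
  have hG : G (x + α • (xh - x)) ≤ (1 - α) * G x + α * G xh := by
    have e : (1 - α) • x + α • xh = x + α • (xh - x) := by module
    exact e ▸ hP.reg_convex.2 hx hxh (sub_nonneg.2 hα1) hα0.le (by ring)
  have hF := hP.avgLoss_upper hx hxα
  rw [add_sub_cancel_left, inner_smul_right, norm_smul, Real.norm_of_nonneg hα0.le] at hF
  have hdir := h.inner_add_sub_le hP hS hx hxh
  have herr := real_inner_le_norm (gradient (avgLoss f) x - y) (xh - x)
  rw [inner_sub_left] at herr
  set D := ‖xh - x‖
  set e := ‖gradient (avgLoss f) x - y‖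
  have hyoung : e * D ≤ μ₀ / 4 * D ^ 2 + 1 / μ₀ * e ^ 2 := by
    have e1 : μ₀ / 4 * D ^ 2 + 1 / μ₀ * e ^ 2 - e * D = (μ₀ * D - 2 * e) ^ 2 / (4 * μ₀) := by
      field_simp; ring
    have : 0 ≤ (μ₀ * D - 2 * e) ^ 2 / (4 * μ₀) := by positivity
    linarith
  have hcurv : L / 2 * (α * D) ^ 2 ≤ α * (μ₀ / 4 * D ^ 2) := by
    have : α * L * (α * D ^ 2) ≤ μ₀ / 2 * (α * D ^ 2) := by gcongr
    linarith
  have hmon : μ₀ * D ^ 2 ≤ μt i * D ^ 2 := by gcongr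
  have hS1 : objective f G (x + α • (xh - x)) ≤ objective f G x
      + α * (-(μ₀ / 2) * D ^ 2 + 1 / μ₀ * e ^ 2) := by
    have a1 : inner ℝ (gradient (avgLoss f) x) (xh - x) + G xh - G x
        ≤ -(3 / 4 * μ₀) * D ^ 2 + 1 / μ₀ * e ^ 2 := by linarith
    have a2 := mul_le_mul_of_nonneg_left a1 hα0.le
    rw [objective, objective]
    linarith
  have hS2 : objective f G (x + α • (xh - x)) - optValue K f G
      ≤ (1 - α) * (objective f G x - optValue K f G) + α * (A * (D ^ 2 + e ^ 2)) := by
    have := mul_le_mul_of_nonneg_left hopt hα0.le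
    linarith
  have b1 := mul_le_mul_of_nonneg_left hS1 (show 0 ≤ 1 - θ by linarith)
  have b2 := mul_le_mul_of_nonneg_left hS2 hθ0.le
  have b3 : α * D ^ 2 * (θ * A - (1 - θ) * (μ₀ / 2)) ≤ α * D ^ 2 * (-(μ₀ / 8)) :=
    mul_le_mul_of_nonneg_left (by nlinarith) (by positivity)
  have b4 : α * e ^ 2 * (θ * A + (1 - θ) * (1 / μ₀)) ≤ α * e ^ 2 * (A + 1 / μ₀) := by
    have : 0 < 1 / μ₀ := by positivity
    exact mul_le_mul_of_nonneg_left (by nlinarith) (by positivity)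
  linarith

end LocalStep

/-! ### The interconnected recursions -/

/-- Small-gain argument: for small `α` the weighted sum `p + A X ^ 2 + Y ^ 2` contracts, since the
disagreements `X`, `Y` are driven by `α r`, their squares enter `p` with a factor `α`, and `p`
absorbs `α κ r ^ 2`. -/
theorem exists_geometric_bound {ρ c θ κ : ℝ} (hρ0 : 0 ≤ ρ) (hρ1 : ρ < 1) (hc : 0 ≤ c) (hθ : 0 < θ)
    (hκ : 0 < κ) :
    ∃ a : ℝ, 0 < a ∧ ∀ α : ℝ, 0 < α → α < a → ∀ p X Y r : ℕ → ℝ,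
      (∀ ν, 0 ≤ p ν) → (∀ ν, 0 ≤ X ν) → (∀ ν, 0 ≤ Y ν) → (∀ ν, 0 ≤ r ν) →
      (∀ ν, X (ν + 1) ≤ ρ * X ν + c * (α * r ν)) →
      (∀ ν, Y (ν + 1) ≤ ρ * Y ν + c * (X ν + α * r ν)) →
      (∀ ν, p (ν + 1) ≤ (1 - θ * α) * p ν - α * κ * r ν ^ 2 + α * c * (X ν + Y ν) ^ 2) →
      ∃ z : ℝ, 0 < z ∧ z < 1 ∧ ∃ b : ℝ, ∀ ν, p ν ≤ b * z ^ ν := by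
  have hσ : 0 < 1 - ρ := by linarith
  -- squaring the recursion of `Y` costs the factor `2 / (1 - ρ)`
  set h := 2 * c ^ 2 / (1 - ρ) with hh
  have hh0 : 0 ≤ h := by positivity
  set A := 2 * h / (1 - ρ) + 1 with hA
  have hA1 : 1 ≤ A := by
    have : 0 ≤ 2 * h / (1 - ρ) := by positivity
    linarith
  have hA2 : A * (1 - ρ) = 2 * h + (1 - ρ) := by rw [hA]; field_simp
  refine ⟨min ((1 - ρ) / (2 * c + A * θ)) (κ / ((A + 1) * h + 1)),
    lt_min (by positivity) (by positivity), fun α hα0 hα p X Y r hp hX hY hr hXs hYs hps => ?_⟩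
  have hα1 : α * (2 * c + A * θ) < 1 - ρ :=
    (lt_div_iff₀ (by positivity)).1 (hα.trans_le (min_le_left _ _))
  have hα2 : α * ((A + 1) * h + 1) < κ :=
    (lt_div_iff₀ (by positivity)).1 (hα.trans_le (min_le_right _ _))
  have hθα : θ * α ≤ A * (θ * α) := le_mul_of_one_le_left (by positivity) hA1
  have hcα : 0 ≤ c * α := by positivity
  have hz1 : 0 < 1 - θ * α := by linarith
  have square : ∀ {u s v : ℝ}, 0 ≤ u → 0 ≤ v → v ≤ ρ * u + s → v ^ 2 ≤ ρ * u ^ 2 + s ^ 2 / (1 - ρ) := by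
    intro u s v hu hv hle
    have e1 : ρ * u ^ 2 + s ^ 2 / (1 - ρ) - (ρ * u + s) ^ 2
        = ρ * ((1 - ρ) * u - s) ^ 2 / (1 - ρ) := by field_simp; ring
    have : 0 ≤ ρ * ((1 - ρ) * u - s) ^ 2 / (1 - ρ) := by positivity
    have : v ^ 2 ≤ (ρ * u + s) ^ 2 := by gcongr
    linarith
  have hV : ∀ ν, p ν + A * X ν ^ 2 + Y ν ^ 2
      ≤ (p 0 + A * X 0 ^ 2 + Y 0 ^ 2) * (1 - θ * α) ^ ν := by
    intro ν
    induction ν with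
    | zero => simp
    | succ ν ih =>
      have hX2 : X (ν + 1) ^ 2 ≤ ρ * X ν ^ 2 + h * (α * r ν) ^ 2 := by
        refine (square (hX ν) (hX _) (hXs ν)).trans (add_le_add le_rfl ?_)
        rw [hh, div_mul_eq_mul_div]
        refine div_le_div_of_nonneg_right ?_ hσ.le
        nlinarith [sq_nonneg (c * (α * r ν))]
      have hY2 : Y (ν + 1) ^ 2 ≤ ρ * Y ν ^ 2 + h * (X ν ^ 2 + (α * r ν) ^ 2) := by
        refine (square (hY ν) (hY _) (hYs ν)).trans (add_le_add le_rfl ?_)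
        rw [hh, div_mul_eq_mul_div]
        refine div_le_div_of_nonneg_right ?_ hσ.le
        nlinarith [sq_nonneg (c * (X ν - α * r ν))]
      have hp2 : α * c * (X ν + Y ν) ^ 2 ≤ 2 * (c * α) * (X ν ^ 2 + Y ν ^ 2) := by
        nlinarith [mul_nonneg hcα (sq_nonneg (X ν - Y ν))]
      have hA3 := mul_le_mul_of_nonneg_left hX2 (show 0 ≤ A by linarith)
      have k1 : (A * ρ + h + 2 * (c * α)) * X ν ^ 2 ≤ (1 - θ * α) * A * X ν ^ 2 :=
        mul_le_mul_of_nonneg_right (by linarith) (sq_nonneg _)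
      have k2 : (ρ + 2 * (c * α)) * Y ν ^ 2 ≤ (1 - θ * α) * Y ν ^ 2 :=
        mul_le_mul_of_nonneg_right (by linarith) (sq_nonneg _)
      have k3 : α * r ν ^ 2 * (α * ((A + 1) * h)) ≤ α * r ν ^ 2 * κ :=
        mul_le_mul_of_nonneg_left (by linarith) (by positivity)
      calc p (ν + 1) + A * X (ν + 1) ^ 2 + Y (ν + 1) ^ 2
          ≤ (p ν + A * X ν ^ 2 + Y ν ^ 2) * (1 - θ * α) := by linarith [hps ν]
        _ ≤ (p 0 + A * X 0 ^ 2 + Y 0 ^ 2) * (1 - θ * α) ^ ν * (1 - θ * α) :=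
            mul_le_mul_of_nonneg_right ih hz1.le
        _ = _ := by ring
  refine ⟨1 - θ * α, hz1, by linarith [mul_pos hθ hα0], _, fun ν => le_trans ?_ (hV ν)⟩
  have : 0 ≤ A * X ν ^ 2 := by positivity
  linarith [sq_nonneg (Y ν)]

/-! ### Push-sum weights -/

section PushSum

variable {m : ℕ} {𝓖 : ℕ → Digraph (Fin m)} {C : ℕ → Matrix (Fin m) (Fin m) ℝ} {cl : ℝ} {B : ℕ}

theorem WeightAssumption.nonneg (hC : WeightAssumption 𝓖 C cl) (ν : ℕ) (i j : Fin m) :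
    0 ≤ C ν i j := by
  by_cases hij : i = j
  · subst hij
    exact hC.cl_pos.le.trans (hC.diag ν i)
  by_cases hadj : (𝓖 ν).Adj j i
  · exact hC.cl_pos.le.trans (hC.edge ν i j hij hadj)
  · exact (hC.not_edge ν i j hij hadj).ge

theorem WeightAssumption.le_of_adj (hC : WeightAssumption 𝓖 C cl) (ν : ℕ) (i j : Fin m)
    (h : (𝓖 ν).Adj j i) : cl ≤ C ν i j := by
  by_cases hij : i = j
  · subst hij
    exact hC.diag ν i
  · exact hC.edge ν i j hij h

theorem WeightAssumption.cl_le_one (hC : WeightAssumption 𝓖 C cl) (i : Fin m) : cl ≤ 1 := by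
  rw [← hC.column_stochastic 0 i]
  exact (hC.diag 0 i).trans
    (Finset.single_le_sum (f := fun k => C 0 k i) (fun k _ => hC.nonneg 0 k i) (Finset.mem_univ i))

variable {φ : ℕ → Fin m → ℝ}

theorem WeightAssumption.phi_nonneg (hC : WeightAssumption 𝓖 C cl) (h0 : ∀ i, φ 0 i = 1)
    (hstep : ∀ ν i, φ (ν + 1) i = ∑ j, C ν i j * φ ν j) (ν : ℕ) (i : Fin m) : 0 ≤ φ ν i := by
  induction ν generalizing i with
  | zero => simp [h0]
  | succ ν ih =>
    rw [hstep]
    exact Finset.sum_nonneg fun j _ => mul_nonneg (hC.nonneg _ _ _) (ih j)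

theorem WeightAssumption.phi_sum (hC : WeightAssumption 𝓖 C cl) (h0 : ∀ i, φ 0 i = 1)
    (hstep : ∀ ν i, φ (ν + 1) i = ∑ j, C ν i j * φ ν j) (ν : ℕ) : ∑ i, φ ν i = m := by
  induction ν with
  | zero => simp [h0]
  | succ ν ih =>
    simp only [hstep]
    rw [Finset.sum_comm]
    simp only [← Finset.sum_mul, hC.column_stochastic, one_mul, ih]

theorem phi_add_eq (hstep : ∀ ν i, φ (ν + 1) i = ∑ j, C ν i j * φ ν j) (ν k : ℕ) (i : Fin m) :
    φ (ν + k) i = ∑ j, transition C ν k i j * φ ν j := by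
  induction k generalizing i with
  | zero => simp [transition, Matrix.one_apply]
  | succ k ih =>
    rw [← add_assoc, hstep, transition_succ']
    simp only [ih, Matrix.mul_apply, Finset.sum_mul, Finset.mul_sum, mul_assoc]
    exact Finset.sum_comm

/-- After the window of `(m + 1) B` steps every agent has received a fixed fraction of the total
mass `m`; before that it has kept a fixed fraction of its own. -/
theorem WeightAssumption.phi_lower (hC : WeightAssumption 𝓖 C cl) (hB : IsBStronglyConnected 𝓖 B)
    (h0 : ∀ i, φ 0 i = 1) (hstep : ∀ ν i, φ (ν + 1) i = ∑ j, C ν i j * φ ν j) (ν : ℕ) (i : Fin m) :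
    cl ^ ((m + 1) * B) ≤ φ ν i := by
  have hcl := hC.cl_pos.le
  have hm : (1 : ℝ) ≤ m := by exact_mod_cast i.pos
  have hkeep : ∀ ν i, cl ^ ν ≤ φ ν i := by
    intro ν
    induction ν with
    | zero => simp [h0]
    | succ ν ih =>
      intro i
      rw [hstep, pow_succ']
      exact (mul_le_mul (hC.diag ν i) (ih i) (by positivity) (hC.nonneg _ _ _)).trans
        (Finset.single_le_sum (f := fun j => C ν i j * φ ν j)
          (fun j _ => mul_nonneg (hC.nonneg _ _ _) (hC.phi_nonneg h0 hstep ν j)) (Finset.mem_univ i))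
  rcases le_total ν ((m + 1) * B) with hν | hν
  · exact (pow_le_pow_of_le_one hcl (hC.cl_le_one i) hν).trans (hkeep ν i)
  · obtain ⟨k, rfl⟩ := Nat.exists_eq_add_of_le' hν
    rw [phi_add_eq hstep]
    calc cl ^ ((m + 1) * B) ≤ cl ^ ((m + 1) * B) * ∑ j, φ k j := by
          rw [hC.phi_sum h0 hstep]
          exact le_mul_of_one_le_right (by positivity) hm
      _ ≤ _ := by
          rw [Finset.mul_sum]
          exact Finset.sum_le_sum fun j _ => mul_le_mul_of_nonneg_right
            (pow_le_transition hB hC.nonneg hcl hC.diag hC.le_of_adj k i j)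
            (hC.phi_nonneg h0 hstep k j)

/-- The row-stochastic weights that push-sum effectively applies to the iterates. -/
def pushSumWeight (C : ℕ → Matrix (Fin m) (Fin m) ℝ) (φ : ℕ → Fin m → ℝ) (ν : ℕ) :
    Matrix (Fin m) (Fin m) ℝ :=
  Matrix.of fun i j => C ν i j * φ ν j / φ (ν + 1) i

theorem pushSumWeight_nonneg (hC : WeightAssumption 𝓖 C cl) (hφ : ∀ ν i, 0 < φ ν i) (ν : ℕ)
    (i j : Fin m) : 0 ≤ pushSumWeight C φ ν i j :=
  div_nonneg (mul_nonneg (hC.nonneg _ _ _) (hφ _ _).le) (hφ _ _).le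

theorem pushSumWeight_row_sum (hφ : ∀ ν i, 0 < φ ν i)
    (hstep : ∀ ν i, φ (ν + 1) i = ∑ j, C ν i j * φ ν j) (ν : ℕ) (i : Fin m) :
    ∑ j, pushSumWeight C φ ν i j = 1 := by
  simp only [pushSumWeight, Matrix.of_apply, ← Finset.sum_div, ← hstep]
  exact div_self (hφ _ _).ne'

theorem le_pushSumWeight {φ₀ : ℝ} (hφ₀ : 0 < φ₀) (hφ : ∀ ν i, φ₀ ≤ φ ν i)
    (hsum : ∀ ν, ∑ i, φ ν i = m) (hcl : 0 < cl) {ν : ℕ} {i j : Fin m} (h : cl ≤ C ν i j) :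
    cl * φ₀ / m ≤ pushSumWeight C φ ν i j := by
  have hle : φ (ν + 1) i ≤ m := by
    rw [← hsum (ν + 1)]
    exact Finset.single_le_sum (f := fun k => φ (ν + 1) k) (fun k _ => hφ₀.le.trans (hφ _ k))
      (Finset.mem_univ i)
  exact div_le_div₀ (mul_nonneg (hcl.le.trans h) (hφ₀.le.trans (hφ _ _)))
    (mul_le_mul h (hφ _ _) hφ₀.le (hcl.le.trans h)) (hφ₀.trans_le (hφ _ _)) hle

end PushSum

/-! ### Invariants of a run -/

section Run

variable {m d : ℕ} {K O : Set (Vec d)} {f : Fin m → Vec d → ℝ} {G : Vec d → ℝ} {μ L : ℝ}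
  {ft : Fin m → Vec d → Vec d → ℝ} {μt Lt : Fin m → ℝ}
  {𝓖 : ℕ → Digraph (Fin m)} {C : ℕ → Matrix (Fin m) (Fin m) ℝ} {cl α : ℝ}
  {x xhat y : ℕ → Fin m → Vec d} {φ : ℕ → Fin m → ℝ}

theorem IsRun.x_succ (hR : IsRun K f ft G C α x xhat y φ) (ν : ℕ) :
    x (ν + 1) = mix (pushSumWeight C φ ν) (x ν + α • (xhat ν - x ν)) := by
  ext1 i
  rw [hR.x_step, mix, Finset.smul_sum]
  refine Finset.sum_congr rfl fun j _ => ?_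
  rw [smul_smul, pushSumWeight, Matrix.of_apply, one_div, inv_mul_eq_div]
  rfl

/-- The perturbation of the gradient estimates by the change of the local gradients. -/
def gradientChange (f : Fin m → Vec d → ℝ) (x : ℕ → Fin m → Vec d) (φ : ℕ → Fin m → ℝ) (ν : ℕ)
    (j : Fin m) : Vec d :=
  (1 / φ ν j) • (gradient (f j) (x (ν + 1) j) - gradient (f j) (x ν j))

theorem IsRun.y_succ (hR : IsRun K f ft G C α x xhat y φ) (hφ : ∀ ν i, 0 < φ ν i) (ν : ℕ) :
    y (ν + 1) = mix (pushSumWeight C φ ν) (y ν + gradientChange f x φ ν) := by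
  ext1 i
  rw [hR.y_step, mix, Finset.smul_sum]
  refine Finset.sum_congr rfl fun j _ => ?_
  have hj := (hφ ν j).ne'
  rw [pushSumWeight, Matrix.of_apply, Pi.add_apply, gradientChange, add_sub_assoc, smul_smul,
    smul_add, smul_add, smul_smul, smul_smul]
  congr 2
  · ring
  · field_simp

/-- The mean of the gradient estimates with weights `φ` is the mean of the local gradients. -/
theorem IsRun.sum_tracking (hR : IsRun K f ft G C α x xhat y φ) (hC : WeightAssumption 𝓖 C cl)
    (hφ : ∀ ν i, 0 < φ ν i) (ν : ℕ) :
    ∑ i, φ ν i • y ν i = ∑ i, gradient (f i) (x ν i) := by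
  induction ν with
  | zero => simp [hR.φ_init, hR.y_init]
  | succ ν ih =>
    have h1 : ∀ i, φ (ν + 1) i • y (ν + 1) i = ∑ j, C ν i j •
        (φ ν j • y ν j + gradient (f j) (x (ν + 1) j) - gradient (f j) (x ν j)) := fun i => by
      rw [hR.y_step, smul_smul, mul_one_div_cancel (hφ _ _).ne', one_smul]
    simp only [h1]
    rw [Finset.sum_comm]
    simp only [← Finset.sum_smul, hC.column_stochastic, one_smul]
    rw [Finset.sum_sub_distrib, Finset.sum_add_distrib, ih]
    abel

theorem IsRun.x_mem (hR : IsRun K f ft G C α x xhat y φ) (hC : WeightAssumption 𝓖 C cl)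
    (hφ : ∀ ν i, 0 < φ ν i) (hK : Convex ℝ K) (hα0 : 0 ≤ α) (hα1 : α ≤ 1) (ν : ℕ) (i : Fin m) :
    x ν i ∈ K := by
  induction ν generalizing i with
  | zero => exact hR.x_init i
  | succ ν ih =>
    rw [hR.x_succ]
    refine hK.sum_mem (fun j _ => pushSumWeight_nonneg hC hφ ν i j)
      (pushSumWeight_row_sum hφ hR.φ_step ν i) fun j _ => ?_
    have e : (1 - α) • x ν j + α • xhat ν j = (x ν + α • (xhat ν - x ν)) j := by
      simp only [Pi.add_apply, Pi.smul_apply, Pi.sub_apply]; module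
    exact e ▸ hK (ih j) (hR.xhat_mem ν j) (sub_nonneg.2 hα1) hα0 (by ring)

/-- Jensen's inequality and column stochasticity: mixing does not increase the total of a convex
function with weights `φ`. -/
theorem IsRun.sum_phi_mul_le (hR : IsRun K f ft G C α x xhat y φ) (hC : WeightAssumption 𝓖 C cl)
    (hφ : ∀ ν i, 0 < φ ν i) {U : Vec d → ℝ} (hU : ConvexOn ℝ K U) (hα0 : 0 ≤ α) (hα1 : α ≤ 1)
    (ν : ℕ) :
    ∑ i, φ (ν + 1) i * U (x (ν + 1) i) ≤ ∑ j, φ ν j * U (x ν j + α • (xhat ν j - x ν j)) := by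
  have hmem : ∀ j, x ν j + α • (xhat ν j - x ν j) ∈ K := fun j => by
    have e : (1 - α) • x ν j + α • xhat ν j = x ν j + α • (xhat ν j - x ν j) := by module
    exact e ▸ hU.1 (hR.x_mem hC hφ hU.1 hα0 hα1 ν j) (hR.xhat_mem ν j) (sub_nonneg.2 hα1) hα0
      (by ring)
  calc ∑ i, φ (ν + 1) i * U (x (ν + 1) i)
      ≤ ∑ i, ∑ j, C ν i j * φ ν j * U (x ν j + α • (xhat ν j - x ν j)) := by
        refine Finset.sum_le_sum fun i _ => ?_
        have h1 := hU.map_sum_le (fun j _ => pushSumWeight_nonneg hC hφ ν i j)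
          (pushSumWeight_row_sum hφ hR.φ_step ν i) fun j _ => hmem j
        have h2 := mul_le_mul_of_nonneg_left h1 (hφ (ν + 1) i).le
        rw [hR.x_succ ν]
        refine h2.trans_eq ?_
        rw [Finset.mul_sum]
        refine Finset.sum_congr rfl fun j _ => ?_
        rw [pushSumWeight, Matrix.of_apply, smul_eq_mul, ← mul_assoc,
          mul_div_cancel₀ _ (hφ (ν + 1) i).ne']
    _ = _ := by
        rw [Finset.sum_comm]
        refine Finset.sum_congr rfl fun j _ => ?_
        rw [← Finset.sum_mul, ← Finset.sum_mul, hC.column_stochastic, one_mul]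

theorem IsRun.norm_gradientChange_le (hP : ProblemAssumption K O f G μ L)
    (hR : IsRun K f ft G C α x xhat y φ) (hC : WeightAssumption 𝓖 C cl) {φ₀ : ℝ} (hφ₀ : 0 < φ₀)
    (hφ : ∀ ν i, φ₀ ≤ φ ν i) (hα0 : 0 ≤ α) (hα1 : α ≤ 1) (ν : ℕ) :
    ‖gradientChange f x φ ν‖ ≤ m * L / φ₀ * (spread (x ν) + α * ‖xhat ν - x ν‖) := by
  have hφ' : ∀ ν i, 0 < φ ν i := fun ν i => hφ₀.trans_le (hφ ν i)
  have hM : 0 ≤ m * L := mul_nonneg (Nat.cast_nonneg m) hP.L_pos.le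
  have hs : 0 ≤ spread (x ν) + α * ‖xhat ν - x ν‖ :=
    add_nonneg (spread_nonneg _) (mul_nonneg hα0 (norm_nonneg _))
  refine (pi_norm_le_iff_of_nonneg (by positivity)).2 fun j => ?_
  have hmove : ‖x (ν + 1) j - x ν j‖ ≤ spread (x ν) + α * ‖xhat ν - x ν‖ := by
    have h1 := pushSumWeight_row_sum hφ' hR.φ_step ν j
    have e : x (ν + 1) j - x ν j = ∑ k, pushSumWeight C φ ν j k •
        ((x ν k - x ν j) + α • (xhat ν - x ν) k) := by
      conv_lhs => rw [hR.x_succ, mix, ← one_smul ℝ (x ν j), ← h1, Finset.sum_smul,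
        ← Finset.sum_sub_distrib]
      refine Finset.sum_congr rfl fun k _ => ?_
      rw [← smul_sub]
      congr 1
      simp only [Pi.add_apply, Pi.smul_apply]
      abel
    rw [e]
    calc _ ≤ ∑ k, pushSumWeight C φ ν j k * (spread (x ν) + α * ‖xhat ν - x ν‖) := by
          refine (norm_sum_le _ _).trans (Finset.sum_le_sum fun k _ => ?_)
          have h0 := pushSumWeight_nonneg hC hφ' ν j k
          rw [norm_smul, Real.norm_of_nonneg h0]
          refine mul_le_mul_of_nonneg_left ((norm_add_le _ _).trans
            (add_le_add (norm_sub_le_spread _ _ _) ?_)) h0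
          rw [norm_smul, Real.norm_of_nonneg hα0]
          exact mul_le_mul_of_nonneg_left (norm_le_pi_norm (xhat ν - x ν) k) hα0
      _ = _ := by rw [← Finset.sum_mul, h1, one_mul]
  have hmem := fun ν => hR.x_mem hC hφ' hP.convex hα0 hα1 ν j
  have h2 := hP.norm_gradient_sub_le j (hmem ν) (hmem (ν + 1))
  rw [gradientChange, norm_smul, Real.norm_of_nonneg (one_div_nonneg.2 (hφ' ν j).le)]
  calc _ ≤ 1 / φ₀ * (m * L * (spread (x ν) + α * ‖xhat ν - x ν‖)) :=
        mul_le_mul (one_div_le_one_div_of_le hφ₀ (hφ ν j))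
          (h2.trans (mul_le_mul_of_nonneg_left hmove hM)) (norm_nonneg _) (by positivity)
    _ = _ := by ring

theorem IsRun.norm_gradient_sub_le (hP : ProblemAssumption K O f G μ L)
    (hR : IsRun K f ft G C α x xhat y φ) (hC : WeightAssumption 𝓖 C cl)
    (hφ : ∀ ν i, 0 < φ ν i) (hα0 : 0 ≤ α) (hα1 : α ≤ 1) (ν : ℕ) (i : Fin m) :
    ‖gradient (avgLoss f) (x ν i) - y ν i‖ ≤ m * L * spread (x ν) + spread (y ν) := by
  have hm : (0 : ℝ) < m := by exact_mod_cast i.pos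
  have hM : 0 ≤ m * L := mul_nonneg (Nat.cast_nonneg m) hP.L_pos.le
  have hmem := hR.x_mem hC hφ hP.convex hα0 hα1 ν
  have hsum := hC.phi_sum hR.φ_init hR.φ_step ν
  have e : gradient (avgLoss f) (x ν i) - y ν i
      = (1 / (m : ℝ)) • ∑ j, (gradient (f j) (x ν i) - gradient (f j) (x ν j))
        + (1 / (m : ℝ)) • ∑ j, φ ν j • (y ν j - y ν i) := by
    simp only [hP.gradient_avgLoss (hP.subset (hmem i)), smul_sub, Finset.sum_sub_distrib,
      hR.sum_tracking hC hφ, ← Finset.sum_smul, hsum, smul_smul, one_div_mul_cancel hm.ne', one_smul]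
    abel
  rw [e]
  refine (norm_add_le _ _).trans (add_le_add (norm_average_le i.pos fun j => ?_) ?_)
  · exact (hP.norm_gradient_sub_le j (hmem j) (hmem i)).trans
      (mul_le_mul_of_nonneg_left (norm_sub_le_spread _ _ _) hM)
  · rw [norm_smul, Real.norm_of_nonneg (by positivity), one_div, inv_mul_le_iff₀ hm]
    calc ‖∑ j, φ ν j • (y ν j - y ν i)‖ ≤ ∑ j, φ ν j * spread (y ν) := by
          refine (norm_sum_le _ _).trans (Finset.sum_le_sum fun j _ => ?_)
          rw [norm_smul, Real.norm_of_nonneg (hφ ν j).le]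
          exact mul_le_mul_of_nonneg_left (norm_sub_le_spread _ _ _) (hφ ν j).le
      _ = _ := by rw [← Finset.sum_mul, hsum]

theorem sq_norm_le_sum (v : Fin m → Vec d) : ‖v‖ ^ 2 ≤ ∑ j, ‖v j‖ ^ 2 := by
  have h0 : 0 ≤ ∑ j, ‖v j‖ ^ 2 := Finset.sum_nonneg fun j _ => sq_nonneg _
  have h : ‖v‖ ≤ Real.sqrt (∑ j, ‖v j‖ ^ 2) := (pi_norm_le_iff_of_nonneg (Real.sqrt_nonneg _)).2
    fun j => Real.le_sqrt_of_sq_le (Finset.single_le_sum (f := fun j => ‖v j‖ ^ 2)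
      (fun j _ => sq_nonneg _) (Finset.mem_univ j))
  exact (Real.le_sqrt (norm_nonneg _) h0).1 h

end Run

/-! ### Convergence -/

section Convergence

variable {m d : ℕ} {K O : Set (Vec d)} {f : Fin m → Vec d → ℝ} {G : Vec d → ℝ} {μ L : ℝ}
  {ft : Fin m → Vec d → Vec d → ℝ} {μt Lt : Fin m → ℝ}
  {𝓖 : ℕ → Digraph (Fin m)} {C : ℕ → Matrix (Fin m) (Fin m) ℝ} {cl α : ℝ}
  {x xhat y : ℕ → Fin m → Vec d} {φ : ℕ → Fin m → ℝ}

/-- Every agent keeps a fixed fraction of the push-sum weight, and disagreement under the effective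
weights is measured by functionals `N ν` that dominate the spread and contract by a fixed factor at
every step. The constants depend on the network only. -/
theorem WeightAssumption.exists_contraction (hC : WeightAssumption 𝓖 C cl) {B : ℕ}
    (hB : IsBStronglyConnected 𝓖 B) (hm : 0 < m) (E : Type*) [NormedAddCommGroup E]
    [NormedSpace ℝ E] :
    ∃ φ₀ ρ c : ℝ, 0 < φ₀ ∧ 0 ≤ ρ ∧ ρ < 1 ∧ 0 ≤ c ∧ ∀ φ : ℕ → Fin m → ℝ, (∀ i, φ 0 i = 1) →
      (∀ ν i, φ (ν + 1) i = ∑ j, C ν i j * φ ν j) → (∀ ν i, φ₀ ≤ φ ν i) ∧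
      ∃ N : ℕ → (Fin m → E) → ℝ, (∀ ν v, spread v ≤ N ν v) ∧
        ∀ ν v e, N (ν + 1) (mix (pushSumWeight C φ ν) (v + e)) ≤ ρ * N ν v + c * ‖e‖ := by
  have hm1 : (1 : ℝ) ≤ m := by exact_mod_cast hm
  have hcl := hC.cl_pos
  have hcl1 : cl ≤ 1 := hC.cl_le_one ⟨0, hm⟩
  set T := (m + 1) * B with hT
  have hT0 : 0 < T := Nat.mul_pos m.succ_pos hB.1
  have hT1 : (1 : ℝ) ≤ T := by exact_mod_cast hT0
  -- lower bounds of `φ`, of the effective weights, and of their products over `T` steps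
  set φ₀ := cl ^ T with hφ₀
  have hφ₀pos : 0 < φ₀ := by positivity
  have hφ₀1 : φ₀ ≤ 1 := pow_le_one₀ hcl.le hcl1
  set w := cl * φ₀ / m with hw
  have hw0 : 0 < w := by positivity
  have hw1 : w ≤ 1 := by
    rw [hw, div_le_one (by positivity)]
    exact (mul_le_one₀ hcl1 hφ₀pos.le hφ₀1).trans hm1
  set δ := w ^ T with hδ
  have hδ0 : 0 < δ := by positivity
  have hδ1 : δ ≤ 1 := pow_le_one₀ hw0.le hw1
  refine ⟨φ₀, 1 - δ ^ 2 / T, 2 * T, hφ₀pos, ?_, ?_, by positivity, fun φ h0 hstep => ?_⟩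
  · rw [sub_nonneg, div_le_one (by positivity)]
    exact (pow_le_one₀ hδ0.le hδ1).trans hT1
  · have : 0 < δ ^ 2 / T := by positivity
    linarith
  have hφ : ∀ ν i, φ₀ ≤ φ ν i := hC.phi_lower hB h0 hstep
  have hφ' : ∀ ν i, 0 < φ ν i := fun ν i => hφ₀pos.trans_le (hφ ν i)
  have hsum := hC.phi_sum h0 hstep
  have hW0 := pushSumWeight_nonneg hC hφ'
  have hWpos : ∀ ν i j, δ ≤ transition (pushSumWeight C φ) ν T i j :=
    pow_le_transition hB hW0 hw0.le (fun ν i => le_pushSumWeight hφ₀pos hφ hsum hcl (hC.diag ν i))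
      fun ν i j h => le_pushSumWeight hφ₀pos hφ hsum hcl (hC.le_of_adj ν i j h)
  exact ⟨hφ, fun ν v => energy (pushSumWeight C φ) T ν v, fun ν v => spread_le_energy _ hT0 ν v,
    energy_mix_add_le hW0 (pushSumWeight_row_sum hφ' hstep) hT0 hδ0.le hδ1 hWpos⟩

/-- The optimality gaps of the agents, summed with weights `φ`. -/
def weightedGap (K : Set (Vec d)) (f : Fin m → Vec d → ℝ) (G : Vec d → ℝ)
    (x : ℕ → Fin m → Vec d) (φ : ℕ → Fin m → ℝ) (ν : ℕ) : ℝ :=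
  ∑ i, φ ν i * (objective f G (x ν i) - optValue K f G)

theorem IsRun.weightedGap_succ_le (hP : ProblemAssumption K O f G μ L)
    (hS : SurrogateAssumption K O f ft μt Lt) (hR : IsRun K f ft G C α x xhat y φ)
    (hC : WeightAssumption 𝓖 C cl) {φ₀ : ℝ} (hφ₀ : 0 < φ₀) (hφ : ∀ ν i, φ₀ ≤ φ ν i)
    {Λ μ₀ A θ : ℝ} (hΛ : ∀ i, Lt i ≤ Λ) (hΛ0 : 0 ≤ Λ) (hμ₀ : 0 < μ₀)
    (hμt : ∀ i, μ₀ ≤ μt i) (hA : A = (m * L + Λ + 1) ^ 2 / μ) (hθ0 : 0 < θ) (hθ1 : θ ≤ 1 / 4)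
    (hθA : θ * A ≤ μ₀ / 4) (hα0 : 0 < α) (hα1 : α ≤ 1) (hαL : α * L ≤ μ₀ / 2) (ν : ℕ) :
    weightedGap K f G x φ (ν + 1) ≤ (1 - θ * α) * weightedGap K f G x φ ν
      - α * (μ₀ / 8 * φ₀) * ‖xhat ν - x ν‖ ^ 2
      + α * (m * (A + 1 / μ₀)) * (m * L * spread (x ν) + spread (y ν)) ^ 2 := by
  have hφ' : ∀ ν i, 0 < φ ν i := fun ν i => hφ₀.trans_le (hφ ν i)
  have hA0 : 0 ≤ A := by rw [hA]; have := hP.mu_pos; positivity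
  have hmem := hR.x_mem hC hφ' hP.convex hα0.le hα1
  set E := m * L * spread (x ν) + spread (y ν) with hE
  have hU : ConvexOn ℝ K fun z => objective f G z - optValue K f G :=
    hP.convexOn_objective.sub (concaveOn_const _ hP.convex)
  have hterm : ∀ j, φ ν j * (objective f G (x ν j + α • (xhat ν j - x ν j)) - optValue K f G)
      ≤ (1 - θ * α) * (φ ν j * (objective f G (x ν j) - optValue K f G))
        - α * (μ₀ / 8 * φ₀) * ‖xhat ν j - x ν j‖ ^ 2 + α * (A + 1 / μ₀) * E ^ 2 * φ ν j := by
    intro j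
    have h1 := IsBestResponse.objective_step_le hP hS (hR.xhat_min ν j) (hmem ν j) (hR.xhat_mem ν j)
      (hΛ j) hΛ0 hμ₀ (hμt j) hA hθ0 hθ1 hθA hα0 hα1 hαL
    have h2 : ‖gradient (avgLoss f) (x ν j) - y ν j‖ ^ 2 ≤ E ^ 2 :=
      pow_le_pow_left₀ (norm_nonneg _) (hR.norm_gradient_sub_le hP hC hφ' hα0.le hα1 ν j) 2
    have h3 := mul_le_mul_of_nonneg_left h2 (show 0 ≤ α * (A + 1 / μ₀) by positivity)
    have h4 := mul_le_mul_of_nonneg_left (h1.trans (add_le_add le_rfl h3)) (hφ' ν j).le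
    have h5 := mul_le_mul_of_nonneg_right (hφ ν j)
      (show 0 ≤ α * (μ₀ / 8) * ‖xhat ν j - x ν j‖ ^ 2 by positivity)
    linarith
  have hnorm := mul_le_mul_of_nonneg_left (sq_norm_le_sum (xhat ν - x ν))
    (show 0 ≤ α * (μ₀ / 8 * φ₀) by positivity)
  simp only [Pi.sub_apply] at hnorm
  calc weightedGap K f G x φ (ν + 1)
      ≤ ∑ j, φ ν j * (objective f G (x ν j + α • (xhat ν j - x ν j)) - optValue K f G) :=
        hR.sum_phi_mul_le hC hφ' hU hα0.le hα1 ν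
    _ ≤ _ := Finset.sum_le_sum fun j _ => hterm j
    _ = (1 - θ * α) * weightedGap K f G x φ ν
        - α * (μ₀ / 8 * φ₀) * ∑ j, ‖xhat ν j - x ν j‖ ^ 2 + α * (m * (A + 1 / μ₀)) * E ^ 2 := by
        rw [Finset.sum_add_distrib, Finset.sum_sub_distrib, ← Finset.mul_sum, ← Finset.mul_sum,
          ← Finset.mul_sum, hC.phi_sum hR.φ_init hR.φ_step, weightedGap]
        ring
    _ ≤ _ := by linarith

end Convergence

end Sonata

end

theorem theorem4p5 {m d : ℕ} (K O : Set (Sonata.Vec d))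
    (f : Fin m → Sonata.Vec d → ℝ) (G : Sonata.Vec d → ℝ) (μ L : ℝ)
    (hP : Sonata.ProblemAssumption K O f G μ L)
    (𝓖 : ℕ → Digraph (Fin m)) (B : ℕ) (hB : Sonata.IsBStronglyConnected 𝓖 B)
    (ft : Fin m → Sonata.Vec d → Sonata.Vec d → ℝ) (μt Lt : Fin m → ℝ)
    (hS : Sonata.SurrogateAssumption K O f ft μt Lt)
    (C : ℕ → Matrix (Fin m) (Fin m) ℝ) (cl : ℝ)
    (hC : Sonata.WeightAssumption 𝓖 C cl)
    (Dl : Fin m → ℝ) (hD : Sonata.HessianGapLowerBound K f ft Dl)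
    (hμD : (⨅ i, Dl i) ≤ ⨅ i, μt i) :
    ∃ αbar : ℝ, 0 < αbar ∧ αbar ≤ 1 ∧
      ∀ α : ℝ, 0 < α → α < αbar →
        ∀ (x xhat y : ℕ → Fin m → Sonata.Vec d) (φ : ℕ → Fin m → ℝ),
          Sonata.IsRun K f ft G C α x xhat y φ →
            ∀ i : Fin m,
              Sonata.ConvergesRLinearly (fun ν => Sonata.objective f G (x ν i))
                (Sonata.optValue K f G) := by
  open Sonata in
  rcases Nat.eq_zero_or_pos m with rfl | hm
  · exact ⟨1, one_pos, le_rfl, fun _ _ _ _ _ _ _ _ i => i.elim0⟩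
  have hm1 : (1 : ℝ) ≤ m := by exact_mod_cast hm
  have hμ := hP.mu_pos
  have hL := hP.L_pos
  have hM : 0 ≤ m * L := by positivity
  obtain ⟨μ₀, hμ₀, hμt⟩ : ∃ μ₀ : ℝ, 0 < μ₀ ∧ ∀ i, μ₀ ≤ μt i := by
    obtain ⟨i, -, hi⟩ := Finset.exists_min_image Finset.univ μt ⟨⟨0, hm⟩, Finset.mem_univ _⟩
    exact ⟨μt i, hS.mu_pos i, fun j => hi j (Finset.mem_univ j)⟩
  obtain ⟨Λ, hΛ0, hΛ⟩ : ∃ Λ : ℝ, 0 ≤ Λ ∧ ∀ i, Lt i ≤ Λ :=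
    ⟨∑ i, |Lt i|, Finset.sum_nonneg fun i _ => abs_nonneg _, fun i => (le_abs_self _).trans
      (Finset.single_le_sum (f := fun i => |Lt i|) (fun i _ => abs_nonneg _) (Finset.mem_univ i))⟩
  obtain ⟨φ₀, ρ, cx, hφ₀pos, hρ0, hρ1, hcx0, hnet⟩ := hC.exists_contraction hB hm (Vec d)
  obtain ⟨A, hA⟩ : ∃ A, A = (m * L + Λ + 1) ^ 2 / μ := ⟨_, rfl⟩
  have hA0 : 0 ≤ A := by rw [hA]; positivity
  obtain ⟨θ, hθ0, hθ1, hθA⟩ : ∃ θ : ℝ, 0 < θ ∧ θ ≤ 1 / 4 ∧ θ * A ≤ μ₀ / 4 := by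
    refine ⟨μ₀ / (4 * (A + μ₀)), by positivity, ?_, ?_⟩
    · rw [div_le_div_iff₀ (by positivity) (by norm_num)]
      linarith
    · rw [div_mul_eq_mul_div, div_le_div_iff₀ (by positivity) (by norm_num)]
      nlinarith
  obtain ⟨cy, hcy⟩ : ∃ cy, cy = cx * (m * L / φ₀) := ⟨_, rfl⟩
  obtain ⟨cp, hcp⟩ : ∃ cp, cp = m * (A + 1 / μ₀) * (m * L + 1) ^ 2 := ⟨_, rfl⟩
  have hcy0 : 0 ≤ cy := by rw [hcy]; positivity
  have hcp0 : 0 ≤ cp := by rw [hcp]; positivity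
  obtain ⟨a, ha, hgeom⟩ := exists_geometric_bound (c := cx + cy + cp) (κ := μ₀ / 8 * φ₀) hρ0 hρ1
    (by positivity) hθ0 (by positivity)
  refine ⟨min 1 (min a (μ₀ / (2 * L))), lt_min one_pos (lt_min ha (by positivity)), min_le_left _ _,
    fun α hα0 hα x xhat y φ hR i => ?_⟩
  have hα1 : α ≤ 1 := (hα.trans_le (min_le_left _ _)).le
  have hαa : α < a := hα.trans_le ((min_le_right _ _).trans (min_le_left _ _))
  have hαL : α * L ≤ μ₀ / 2 := by
    have h1 := (hα.trans_le ((min_le_right _ _).trans (min_le_right _ _))).le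
    rw [le_div_iff₀ (by positivity)] at h1
    linarith
  obtain ⟨hφ, N, hN, hNs⟩ := hnet φ hR.φ_init hR.φ_step
  have hN0 : ∀ ν v, 0 ≤ N ν v := fun ν v => (spread_nonneg v).trans (hN ν v)
  have hφ' : ∀ ν i, 0 < φ ν i := fun ν i => hφ₀pos.trans_le (hφ ν i)
  have hmem := hR.x_mem hC hφ' hP.convex hα0.le hα1
  -- `U` is bounded below on `K` because the first subproblem has a solution
  have hbdd : BddBelow (objective f G '' K) :=
    IsBestResponse.bddBelow hP hS (hR.xhat_min 0 i) (hmem 0 i) (hR.xhat_mem 0 i)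
  have hgap : ∀ ν j, 0 ≤ objective f G (x ν j) - optValue K f G := fun ν j =>
    sub_nonneg.2 (csInf_le hbdd (Set.mem_image_of_mem _ (hmem ν j)))
  have hXs : ∀ ν, N (ν + 1) (x (ν + 1))
      ≤ ρ * N ν (x ν) + (cx + cy + cp) * (α * ‖xhat ν - x ν‖) := fun ν => by
    have h1 := hNs ν (x ν) (α • (xhat ν - x ν))
    rw [← hR.x_succ ν, norm_smul, Real.norm_of_nonneg hα0.le] at h1
    refine h1.trans (add_le_add le_rfl (mul_le_mul_of_nonneg_right ?_ (by positivity)))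
    linarith
  have hYs : ∀ ν, N (ν + 1) (y (ν + 1))
      ≤ ρ * N ν (y ν) + (cx + cy + cp) * (N ν (x ν) + α * ‖xhat ν - x ν‖) := fun ν => by
    have h1 := hNs ν (y ν) (gradientChange f x φ ν)
    rw [← hR.y_succ hφ' ν] at h1
    have h2 := hR.norm_gradientChange_le hP hC hφ₀pos hφ hα0.le hα1 ν
    have h3 : 0 ≤ N ν (x ν) + α * ‖xhat ν - x ν‖ :=
      add_nonneg (hN0 _ _) (mul_nonneg hα0.le (norm_nonneg _))
    refine h1.trans (add_le_add le_rfl ?_)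
    calc cx * ‖gradientChange f x φ ν‖
        ≤ cx * (m * L / φ₀ * (N ν (x ν) + α * ‖xhat ν - x ν‖)) :=
          mul_le_mul_of_nonneg_left (h2.trans (mul_le_mul_of_nonneg_left
            (add_le_add (hN ν (x ν)) le_rfl) (by positivity))) hcx0
      _ = cy * (N ν (x ν) + α * ‖xhat ν - x ν‖) := by rw [hcy]; ring
      _ ≤ _ := mul_le_mul_of_nonneg_right (by linarith) h3
  have hps : ∀ ν, weightedGap K f G x φ (ν + 1) ≤ (1 - θ * α) * weightedGap K f G x φ ν
      - α * (μ₀ / 8 * φ₀) * ‖xhat ν - x ν‖ ^ 2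
      + α * (cx + cy + cp) * (N ν (x ν) + N ν (y ν)) ^ 2 := fun ν => by
    refine (hR.weightedGap_succ_le hP hS hC hφ₀pos hφ hΛ hΛ0 hμ₀ hμt hA hθ0 hθ1 hθA hα0 hα1 hαL
      ν).trans (add_le_add le_rfl ?_)
    have hx0 := spread_nonneg (x ν)
    have hy0 := spread_nonneg (y ν)
    have h1 : m * L * spread (x ν) + spread (y ν)
        ≤ (m * L + 1) * (N ν (x ν) + N ν (y ν)) := by
      have h2 := mul_le_mul_of_nonneg_left (hN ν (x ν)) hM
      have h3 := mul_nonneg hM (hN0 ν (y ν))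
      linarith [hN ν (y ν), hN0 ν (x ν)]
    calc α * (m * (A + 1 / μ₀)) * (m * L * spread (x ν) + spread (y ν)) ^ 2
        ≤ α * (m * (A + 1 / μ₀)) * ((m * L + 1) * (N ν (x ν) + N ν (y ν))) ^ 2 :=
          mul_le_mul_of_nonneg_left (pow_le_pow_left₀ (by positivity) h1 2) (by positivity)
      _ = α * cp * (N ν (x ν) + N ν (y ν)) ^ 2 := by rw [hcp]; ring
      _ ≤ _ := mul_le_mul_of_nonneg_right (mul_le_mul_of_nonneg_left (by linarith) hα0.le)
          (sq_nonneg _)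
  obtain ⟨z, hz0, hz1, b, hb⟩ := hgeom α hα0 hαa (weightedGap K f G x φ)
    (fun ν => N ν (x ν)) (fun ν => N ν (y ν)) (fun ν => ‖xhat ν - x ν‖)
    (fun ν => Finset.sum_nonneg fun j _ => mul_nonneg (hφ' ν j).le (hgap ν j))
    (fun ν => hN0 _ _) (fun ν => hN0 _ _) (fun ν => norm_nonneg _) hXs hYs hps
  refine ⟨z, hz0, hz1, b / φ₀, fun ν => ?_⟩
  rw [abs_of_nonneg (hgap ν i), div_mul_eq_mul_div, le_div_iff₀ hφ₀pos]
  calc (objective f G (x ν i) - optValue K f G) * φ₀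
      ≤ φ ν i * (objective f G (x ν i) - optValue K f G) := by
        rw [mul_comm]
        exact mul_le_mul_of_nonneg_right (hφ ν i) (hgap ν i)
    _ ≤ weightedGap K f G x φ ν :=
        Finset.single_le_sum (f := fun j => φ ν j * (objective f G (x ν j) - optValue K f G))
          (fun j _ => mul_nonneg (hφ' ν j).le (hgap ν j)) (Finset.mem_univ i)
    _ ≤ b * z ^ ν := hb ν
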